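/- Let $G$ be a totally disconnected, locally compact group. Let $B(G)$ be the set of compact open subgroups of $G$, with the metric $d(V,W)=\log\bigl(|V:V\cap W|\cdot|W:V\cap W|\bigr)$. For a bicontinuous automorphism $\alpha$ of $G$, a subgroup $O\in B(G)$ is tidy for $\alpha$ if the function $V\mapsto d(\alpha(V),V)$ on $B(G)$ attains its minimum at $O$; the scale of $\alpha$ is $s_G(\alpha)=|\alpha(O):\alpha(O)\cap O|=\min_{V\in B(G)}|\alpha(V):\alpha(V)\cap V|$, where $O$ is tidy for $\alpha$. A group $\mathcal H$ of bicontinuous automorphisms of $G$ is flat if some $O\in B(G)$ is tidy for all elements of $\mathcal H$; then $\mathcal H(1)=\{\alpha\in\mathcal H : s_G(\alpha)=1=s_G(\alpha^{-1})\}$ is a normal subgroup of $\mathcal H$, the quotient $\mathcal H/\mathcal H(1)$ is free abelian, and its $\mathbb Z$-rank is the flat rank of $\mathcal H$. A subgroup $H$ of $G$ is flat, of flat rank $n$, if the group of inner automorphisms of $G$ induced by $H$ is. A map $f\colon X\to Y$ of metric spaces is a quasi-isometric embedding if there are $L\ge 1$ and $C\ge 0$ with $L^{-1}d(x,y)-C\le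 d(f(x),f(y))\le L\,d(x,y)+C$ for all $x,y\in X$; it is a quasi-isometry if, moreover, every point of $Y$ is within a bounded distance (independent of the point) of $f(X)$. A subset of a metric space $X$ is an $n$-dimensional quasi-flat in $X$ if, with the induced metric, it is quasi-isometric to the Euclidean space $\mathbb R^n$. **Proposition.** Suppose that $G$ acts on a metric space $X$ (not necessarily by isometries) such that the stabilizers $G_x$ of all points $x\in X$ are compact open subgroups of $G$, and that the map $X\to B(G)$, $x\mapsto G_x$, is a quasi-isometric embedding. Let $H$ be a flat subgroup of $G$ of finite flat rank $n$. Then for every $x\in X$ the orbit $H.x$ is an $n$-dimensional quasi-flat in $X$. -/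

import Mathlib

/-! ### Quasi-isometries and quasi-flats -/

/-- `f` is a quasi-isometric embedding: for some `L ≥ 1` and `C ≥ 0`,
`L⁻¹ d(x,y) - C ≤ d(f x, f y) ≤ L d(x,y) + C` for all `x, y`. -/
def IsQuasiIsometricEmbedding {X Y : Type*} [PseudoMetricSpace X] [PseudoMetricSpace Y]
    (f : X → Y) : Prop :=
  ∃ L C : ℝ, 1 ≤ L ∧ 0 ≤ C ∧ ∀ x y : X,
    L⁻¹ * dist x y - C ≤ dist (f x) (f y) ∧ dist (f x) (f y) ≤ L * dist x y + C

/-- A quasi-isometry is a quasi-isometric embedding with quasi-dense image. -/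
def IsQuasiIsometry {X Y : Type*} [PseudoMetricSpace X] [PseudoMetricSpace Y]
    (f : X → Y) : Prop :=
  IsQuasiIsometricEmbedding f ∧ ∃ R : ℝ, ∀ y : Y, ∃ x : X, dist (f x) y ≤ R

/-- A subset `S` of `X` is an `n`-dimensional quasi-flat if, with the metric induced from `X`,
it is quasi-isometric to the Euclidean space `ℝⁿ`. -/
def IsQuasiFlat {X : Type*} [PseudoMetricSpace X] (n : ℕ) (S : Set X) : Prop :=
  ∃ f : EuclideanSpace ℝ (Fin n) → S, IsQuasiIsometry f

/-! ### The metric space of compact open subgroups -/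

/-- The set `B(G)` of compact open subgroups of `G`. -/
def CompactOpenSubgroup (G : Type*) [Group G] [TopologicalSpace G] : Type _ :=
  {V : Subgroup G // IsCompact (V : Set G) ∧ IsOpen (V : Set G)}

namespace CompactOpenSubgroup

variable {G : Type*} [Group G] [TopologicalSpace G]

/-- `V.idx W` is the index `|V : V ∩ W|`. -/
noncomputable def idx (V W : CompactOpenSubgroup G) : ℕ := W.1.relIndex V.1

theorem idx_self (V : CompactOpenSubgroup G) : V.idx V = 1 := Subgroup.relIndex_self V.1

theorem idx_eq_one {V W : CompactOpenSubgroup G} : V.idx W = 1 ↔ V.1 ≤ W.1 :=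
  Subgroup.relIndex_eq_one

/-- The distance `d(V, W) = log (|V : V ∩ W| * |W : W ∩ V|)`. -/
noncomputable instance : Dist (CompactOpenSubgroup G) :=
  ⟨fun V W => Real.log ((V.idx W : ℝ) * (W.idx V : ℝ))⟩

theorem dist_def (V W : CompactOpenSubgroup G) :
    dist V W = Real.log ((V.idx W : ℝ) * (W.idx V : ℝ)) := rfl

variable [IsTopologicalGroup G]

theorem relIndex_ne_zero (K : Subgroup G) (hK : IsOpen (K : Set G))
    (V : CompactOpenSubgroup G) : K.relIndex V.1 ≠ 0 := by
  have : CompactSpace V.1 := isCompact_iff_compactSpace.mp V.2.1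
  have : Finite (V.1 ⧸ K.subgroupOf V.1) :=
    Subgroup.quotient_finite_of_isOpen _ (hK.preimage continuous_subtype_val)
  have : (K.subgroupOf V.1).FiniteIndex := Subgroup.finiteIndex_of_finite_quotient
  exact Subgroup.FiniteIndex.index_ne_zero

theorem idx_ne_zero (V W : CompactOpenSubgroup G) : V.idx W ≠ 0 :=
  relIndex_ne_zero W.1 W.2.2 V

theorem idx_pos (V W : CompactOpenSubgroup G) : 0 < V.idx W :=
  Nat.pos_of_ne_zero (idx_ne_zero V W)

theorem idx_le (U V W : CompactOpenSubgroup G) : U.idx W ≤ U.idx V * V.idx W := by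
  have h1 : (W.1 ⊓ V.1).relIndex U.1 ≠ 0 :=
    relIndex_ne_zero _ (W.2.2.inter V.2.2) U
  have h2 : W.1.relIndex U.1 ≤ (W.1 ⊓ V.1).relIndex U.1 :=
    Subgroup.relIndex_le_of_le_left inf_le_left h1
  have h3 := Subgroup.relIndex_inf_mul_relIndex W.1 V.1 U.1
  have h4 : W.1.relIndex (V.1 ⊓ U.1) ≤ W.1.relIndex V.1 :=
    Subgroup.relIndex_le_of_le_right inf_le_left (idx_ne_zero V W)
  calc U.idx W ≤ W.1.relIndex (V.1 ⊓ U.1) * V.1.relIndex U.1 := h2.trans h3.ge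
    _ ≤ W.1.relIndex V.1 * V.1.relIndex U.1 := Nat.mul_le_mul_right _ h4
    _ = U.idx V * V.idx W := mul_comm _ _

theorem idx_mul_pos (V W : CompactOpenSubgroup G) : (0 : ℝ) < (V.idx W : ℝ) * (W.idx V : ℝ) :=
  mul_pos (Nat.cast_pos.mpr (idx_pos V W)) (Nat.cast_pos.mpr (idx_pos W V))

noncomputable instance : MetricSpace (CompactOpenSubgroup G) where
  dist_self V := by simp [dist_def, idx_self]
  dist_comm V W := by rw [dist_def, dist_def, mul_comm]
  dist_triangle U V W := by
    rw [dist_def, dist_def, dist_def,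
      ← Real.log_mul (idx_mul_pos U V).ne' (idx_mul_pos V W).ne']
    apply Real.log_le_log (idx_mul_pos U W)
    have h1 : (U.idx W : ℝ) ≤ U.idx V * V.idx W := mod_cast idx_le U V W
    have h2 : (W.idx U : ℝ) ≤ W.idx V * V.idx U := mod_cast idx_le W V U
    calc (U.idx W : ℝ) * W.idx U ≤ (U.idx V * V.idx W) * (W.idx V * V.idx U) := by gcongr
      _ = _ := by ring
  eq_of_dist_eq_zero {V W} h := by
    have h1 : (V.idx W : ℝ) * (W.idx V : ℝ) = 1 :=
      Real.eq_one_of_pos_of_log_eq_zero (idx_mul_pos V W) h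
    have h2 : V.idx W * W.idx V = 1 := by exact_mod_cast h1
    have h3 := mul_eq_one.mp h2
    exact Subtype.ext (le_antisymm (idx_eq_one.mp h3.1) (idx_eq_one.mp h3.2))

/-- The ratio `|V : V ∩ W| / |W : V ∩ W|` is multiplicative. -/
theorem idx_cocycle (U V W : CompactOpenSubgroup G) :
    U.idx V * V.idx W * W.idx U = V.idx U * W.idx V * U.idx W := by
  have key : ∀ A B C : CompactOpenSubgroup G,
      C.1.relIndex (A.1 ⊓ B.1) * A.idx B = (A.1 ⊓ B.1 ⊓ C.1).relIndex A.1 := by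
    intro A B C
    have h := Subgroup.relIndex_inf_mul_relIndex C.1 (A.1 ⊓ B.1) A.1
    rw [inf_eq_left.mpr (inf_le_left : A.1 ⊓ B.1 ≤ A.1), Subgroup.inf_relIndex_left,
      inf_comm C.1] at h
    exact h
  have a1 := key U V W
  have a2 := key V U W
  have b1 := key V W U
  have b2 := key W V U
  have c1 := key W U V
  have c2 := key U W V
  rw [inf_comm V.1 U.1] at a2
  rw [inf_comm W.1 V.1] at b2
  rw [inf_comm W.1 U.1] at c1
  have e1 : V.1 ⊓ W.1 ⊓ U.1 = U.1 ⊓ V.1 ⊓ W.1 := by rw [inf_comm, inf_assoc]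
  have e2 : U.1 ⊓ W.1 ⊓ V.1 = U.1 ⊓ V.1 ⊓ W.1 := inf_right_comm _ _ _
  rw [e1] at b1 b2
  rw [e2] at c1 c2
  have p : W.1.relIndex (U.1 ⊓ V.1) * (U.1.relIndex (V.1 ⊓ W.1) * V.1.relIndex (U.1 ⊓ W.1)) ≠ 0 := by
    have n1 : (U.1 ⊓ V.1 ⊓ W.1).relIndex U.1 ≠ 0 :=
      relIndex_ne_zero _ ((U.2.2.inter V.2.2).inter W.2.2) U
    have n2 : (U.1 ⊓ V.1 ⊓ W.1).relIndex V.1 ≠ 0 :=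
      relIndex_ne_zero _ ((U.2.2.inter V.2.2).inter W.2.2) V
    exact mul_ne_zero (left_ne_zero_of_mul (a1 ▸ n1))
      (mul_ne_zero (left_ne_zero_of_mul (b1 ▸ n2)) (left_ne_zero_of_mul (c2 ▸ n1)))
  apply mul_left_cancel₀ p
  calc _ = (W.1.relIndex (U.1 ⊓ V.1) * U.idx V) * (U.1.relIndex (V.1 ⊓ W.1) * V.idx W) *
        (V.1.relIndex (U.1 ⊓ W.1) * W.idx U) := by ring
    _ = (W.1.relIndex (U.1 ⊓ V.1) * V.idx U) * (U.1.relIndex (V.1 ⊓ W.1) * W.idx V) *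
        (V.1.relIndex (U.1 ⊓ W.1) * U.idx W) := by
      rw [a1, b1, c1, a2, b2, c2]; ring
    _ = _ := by ring

end CompactOpenSubgroup

/-! ### Bicontinuous automorphisms, tidy subgroups, flat groups and the flat rank -/

/-- The group `Aut(G)` of bicontinuous automorphisms of `G` (under composition). -/
def BicontAut (G : Type*) [Group G] [TopologicalSpace G] : Subgroup (MulAut G) where
  carrier := {α | Continuous (fun g => α g) ∧ Continuous (fun g => α⁻¹ g)}
  one_mem' := ⟨continuous_id, continuous_id⟩
  mul_mem' := fun {α β} hα hβ =>
    ⟨hα.1.comp hβ.1, by rw [mul_inv_rev]; exact hβ.2.comp hα.2⟩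
  inv_mem' := fun {α} hα => ⟨hα.2, by rw [inv_inv]; exact hα.1⟩

namespace BicontAut

variable {G : Type*} [Group G] [TopologicalSpace G]

/-- The action of `Aut(G)` on `B(G)` by taking images: `α • V = α(V)`. -/
instance : MulAction (BicontAut G) (CompactOpenSubgroup G) where
  smul α V := ⟨V.1.map α.1.toMonoidHom, by
    constructor
    · exact V.2.1.image α.2.1
    · have h : ((V.1.map α.1.toMonoidHom : Subgroup G) : Set G)
          = (fun g => α.1⁻¹ g) ⁻¹' (V.1 : Set G) := by
        ext g
        constructor
        · rintro ⟨v, hv, rfl⟩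
          simpa using hv
        · intro hg
          exact ⟨α.1⁻¹ g, hg, by simp⟩
      rw [h]
      exact V.2.2.preimage α.2.2⟩
  one_smul V := Subtype.ext (Subgroup.map_id V.1)
  mul_smul α β V := Subtype.ext
    (Subgroup.map_map V.1 α.1.toMonoidHom β.1.toMonoidHom).symm

theorem coe_smul (α : BicontAut G) (V : CompactOpenSubgroup G) :
    (α • V).1 = V.1.map α.1.toMonoidHom := rfl

theorem idx_smul (α : BicontAut G) (V W : CompactOpenSubgroup G) :
    (α • V).idx (α • W) = V.idx W :=
  Subgroup.relIndex_map_map_of_injective _ _ α.1.injective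

/-- The scale of `α`: the minimum of `|α(V) : α(V) ∩ V|` over all compact open subgroups `V`;
by `scale_eq_of_isTidy` it is also equal to `|α(O) : α(O) ∩ O|` whenever `O` is tidy for `α`. -/
noncomputable def scale (α : BicontAut G) : ℕ :=
  sInf (Set.range fun V : CompactOpenSubgroup G => (α • V).idx V)

theorem scale_conj (α β : BicontAut G) : scale (β * α * β⁻¹) = scale α := by
  have h : (Set.range fun V : CompactOpenSubgroup G => ((β * α * β⁻¹) • V).idx V)
      = Set.range fun V : CompactOpenSubgroup G => (α • V).idx V := by
    ext k
    constructor
    · rintro ⟨V, rfl⟩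
      refine ⟨β⁻¹ • V, ?_⟩
      simp only
      rw [← idx_smul β, smul_smul, smul_smul, smul_inv_smul, mul_assoc]
    · rintro ⟨V, rfl⟩
      refine ⟨β • V, ?_⟩
      simp only
      rw [smul_smul, inv_mul_cancel_right, mul_smul, idx_smul]
  rw [scale, scale, h]

/-- `O` is tidy for `α` if the displacement function `V ↦ d(α(V), V)` of `α` attains its
minimum at `O`. -/
def IsTidy (O : CompactOpenSubgroup G) (α : BicontAut G) : Prop :=
  ∀ V : CompactOpenSubgroup G, dist (α • O) O ≤ dist (α • V) V

/-- A group of bicontinuous automorphisms is flat if its elements have a common tidy subgroup. -/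
def IsFlat (H : Subgroup (BicontAut G)) : Prop :=
  ∃ O : CompactOpenSubgroup G, ∀ α ∈ H, IsTidy O α

theorem IsTidy.inv {O : CompactOpenSubgroup G} {α : BicontAut G} (h : IsTidy O α) :
    IsTidy O α⁻¹ := by
  have key : ∀ V : CompactOpenSubgroup G, dist (α⁻¹ • V) V = dist (α • V) V := by
    intro V
    rw [CompactOpenSubgroup.dist_def, CompactOpenSubgroup.dist_def, ← idx_smul α (α⁻¹ • V) V,
      ← idx_smul α V (α⁻¹ • V), smul_inv_smul, mul_comm]
  intro V
  rw [key, key]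
  exact h V

variable [IsTopologicalGroup G]

theorem scale_eq_of_isTidy {O : CompactOpenSubgroup G} {α : BicontAut G} (h : IsTidy O α) :
    scale α = (α • O).idx O := by
  apply le_antisymm
  · exact Nat.sInf_le ⟨O, rfl⟩
  · obtain ⟨V, hV⟩ := Nat.sInf_mem
      (⟨_, O, rfl⟩ : (Set.range fun V : CompactOpenSubgroup G => (α • V).idx V).Nonempty)
    change (α • V).idx V = scale α at hV
    rw [← hV]
    -- `a / b = a' / b'` where `a = |α(O) : α(O) ∩ O|`, `b = |O : α(O) ∩ O|`, likewise for `V`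
    have e : (α • O).idx O * V.idx (α • V) = O.idx (α • O) * (α • V).idx V := by
      have h1 := CompactOpenSubgroup.idx_cocycle (α • O) O V
      have h2 := CompactOpenSubgroup.idx_cocycle (α • O) V (α • V)
      rw [idx_smul, idx_smul] at h2
      have p : (α • O).idx V * V.idx (α • O) * (O.idx V * V.idx O) ≠ 0 := by
        simp [CompactOpenSubgroup.idx_ne_zero]
      apply mul_left_cancel₀ p
      calc _ = ((α • O).idx O * O.idx V * V.idx (α • O)) *
            ((α • O).idx V * V.idx (α • V) * V.idx O) := by ring
        _ = _ := by rw [h1, h2]; ring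
    have d := h V
    rw [CompactOpenSubgroup.dist_def, CompactOpenSubgroup.dist_def,
      Real.log_le_log_iff (CompactOpenSubgroup.idx_mul_pos _ _)
        (CompactOpenSubgroup.idx_mul_pos _ _)] at d
    have d' : (α • O).idx O * O.idx (α • O) ≤ (α • V).idx V * V.idx (α • V) := by
      exact_mod_cast d
    by_contra! hlt
    have hb : 0 < V.idx (α • V) := CompactOpenSubgroup.idx_pos _ _
    have hb' : 0 < O.idx (α • O) := CompactOpenSubgroup.idx_pos _ _
    have l1 : V.idx (α • V) < O.idx (α • O) := by
      by_contra! hle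
      have : O.idx (α • O) * (α • V).idx V < (α • O).idx O * V.idx (α • V) := by
        calc _ < O.idx (α • O) * (α • O).idx O := Nat.mul_lt_mul_of_pos_left hlt hb'
          _ ≤ V.idx (α • V) * (α • O).idx O := Nat.mul_le_mul_right _ hle
          _ = _ := mul_comm _ _
      omega
    have l2 : (α • V).idx V * V.idx (α • V) < (α • O).idx O * O.idx (α • O) :=
      Nat.mul_lt_mul_of_lt_of_lt hlt l1
    omega

theorem scale_eq_one_iff {O : CompactOpenSubgroup G} {α : BicontAut G} (h : IsTidy O α) :
    (scale α = 1 ∧ scale α⁻¹ = 1) ↔ α • O = O := by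
  rw [scale_eq_of_isTidy h, scale_eq_of_isTidy h.inv, ← idx_smul α (α⁻¹ • O) O, smul_inv_smul,
    CompactOpenSubgroup.idx_eq_one, CompactOpenSubgroup.idx_eq_one]
  exact ⟨fun h => Subtype.ext (le_antisymm h.1 h.2), fun h => by rw [h]; exact ⟨le_rfl, le_rfl⟩⟩

/-- For a flat group `H` of automorphisms, the subgroup
`H(1) = {α ∈ H | s(α) = 1 = s(α⁻¹)}` of `H`. -/
noncomputable def scaleOne (H : Subgroup (BicontAut G)) (hH : IsFlat H) : Subgroup H where
  carrier := {α | scale α.1 = 1 ∧ scale α.1⁻¹ = 1}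
  one_mem' := by
    obtain ⟨O, hO⟩ := hH
    exact (scale_eq_one_iff (hO _ H.one_mem)).mpr (one_smul _ O)
  mul_mem' := fun {α β} hα hβ => by
    obtain ⟨O, hO⟩ := hH
    have h1 := (scale_eq_one_iff (hO _ α.2)).mp hα
    have h2 := (scale_eq_one_iff (hO _ β.2)).mp hβ
    refine (scale_eq_one_iff (hO _ (α * β).2)).mpr ?_
    rw [Subgroup.coe_mul, mul_smul, h2, h1]
  inv_mem' := fun {α} hα => by
    refine ⟨hα.2, ?_⟩
    rw [Subgroup.coe_inv, inv_inv]
    exact hα.1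

instance scaleOne_normal (H : Subgroup (BicontAut G)) (hH : IsFlat H) :
    (scaleOne H hH).Normal where
  conj_mem α hα β := by
    refine ⟨(scale_conj α.1 β.1).trans hα.1, ?_⟩
    have h : ((β * α * β⁻¹ : H) : BicontAut G)⁻¹ = β.1 * α.1⁻¹ * β.1⁻¹ := by
      simp [mul_assoc]
    rw [h, scale_conj]
    exact hα.2

/-- The flat rank of a flat group `H` of automorphisms: the `ℤ`-rank of `H / H(1)`.
(The `ℤ`-rank of a group is taken to be that of its abelianization, so that the definition makes
sense without knowing beforehand that the group `H / H(1)` is abelian.) -/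
noncomputable def flatRank (H : Subgroup (BicontAut G)) (hH : IsFlat H) : Cardinal :=
  Module.rank ℤ (Additive (Abelianization (H ⧸ scaleOne H hH)))

/-- The homomorphism sending `g` to the inner automorphism `x ↦ g * x * g⁻¹`. -/
def innerAut (G : Type*) [Group G] [TopologicalSpace G] [IsTopologicalGroup G] :
    G →* BicontAut G :=
  MulAut.conj.codRestrict (BicontAut G) fun g => by
    constructor
    · change Continuous fun x : G => g * x * g⁻¹
      fun_prop
    · rw [← map_inv]
      change Continuous fun x : G => g⁻¹ * x * g⁻¹⁻¹
      fun_prop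

end BicontAut

/-- A subgroup `H` of `G` is flat if the group of inner automorphisms of `G` induced by `H` is. -/
def IsFlatSubgroup {G : Type*} [Group G] [TopologicalSpace G] [IsTopologicalGroup G]
    (H : Subgroup G) : Prop :=
  BicontAut.IsFlat (H.map (BicontAut.innerAut G))

/-- The flat rank of a flat subgroup `H` of `G` is the flat rank of the group of inner
automorphisms of `G` induced by `H`. -/
noncomputable def flatRankSubgroup {G : Type*} [Group G] [TopologicalSpace G]
    [IsTopologicalGroup G] (H : Subgroup G) (hH : IsFlatSubgroup H) : Cardinal :=
  BicontAut.flatRank (H.map (BicontAut.innerAut G)) hH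

/-- For an action of `G` on `X` with compact open point stabilizers, the map `X → B(G)` which
assigns to a point its stabilizer. -/
def stabilizerMap {G X : Type*} [Group G] [TopologicalSpace G] [MulAction G X]
    (hstab : ∀ x : X, IsCompact (MulAction.stabilizer G x : Set G) ∧
      IsOpen (MulAction.stabilizer G x : Set G)) (x : X) : CompactOpenSubgroup G :=
  ⟨MulAction.stabilizer G x, hstab x⟩

/-!
Let `O` be tidy for all elements of a flat group `Γ` of automorphisms. The displacement
`l(α) = d(α(O), O)` is the minimal displacement of `α` on `B(G)`, so it is invariant under
conjugation, and `Γ(1)` is the set of its zeros. The proof shows that `l` comes from a norm on the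
abelian group `Γ/Γ(1)`. Up to bounded error, the distance of `h.x` and `h'.x` is comparable to the
norm of the difference of the classes of `h` and `h'`.

*Homogeneity*, `l(α^k) = k l(α)` (`BicontAut.dist_pow_smul`). Put `O_i = α^i(O)` and
`m_k = |O : O ∩ O_k|`; the claim is `m_k = m_1 ^ k`. Minimality of the displacement of `O` compared
with that of `O_0 ∩ ⋯ ∩ O_n` shows that stabilizers of paths `O_0, …, O_n` of cosets act
transitively on the extensions of the path (`BicontAut.IsTidy.exists_forall_mem`). It follows that
`m_1 m_k / m_{k+1}` is a nondecreasing bounded sequence of integers, so it is eventually equal to a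
constant `d`, and for a high power of `α` the sequence `m_1, m_2, m_3` is geometric. In that
case, with this power in place of `α`, the set of cosets of `O_1` which lie between the vertices
`O_0` and `O_2` does not change when the interval is enlarged. Its stabilizer `V` is
a compact open subgroup, and comparing orbits gives
`|V : V ∩ α(V)| * D ≤ m_1` for the ratio `D = m_1 ^ 2 / m_2` (`relIndex_intervalStab_mul_le`).
Minimality of `O` forces `D = 1` (`BicontAut.IsTidy.powIdx_two`), and then `d = 1` for the
original `α`, so that all the ratios are `1`.

*Commutativity* (`IsHomogeneousLength.commutator_eq_zero`). A homogeneous length vanishes on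
commutators: for `c = ⁅x, y⁆`, the number `l(x^m c^k)` is at most the average of the numbers at
`(m - 1, k)` and `(m + 1, k - 1)`. A random walk with these steps leads from `(0, n)` in `2 n` steps
to points at distance of order `√n` from the origin, so `n l(c)` is of order `√n`. Hence `Γ/Γ(1)` is
abelian.

*Lattices* (`IsDiscreteNorm.exists_isQuasiIsometry`). The values of the norm at nonzero elements are
at least `log 2`. By Dirichlet's approximation theorem the norm therefore dominates the coefficients
with respect to `n` linearly independent elements, and if `n` is the rank, every element is at
bounded distance from their integral combinations. Rounding coordinates down then gives a
quasi-isometry from `ℝⁿ`.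
-/

/-! ### Relative indices as numbers of cosets -/

theorem Subgroup.relIndex_eq_ncard_image {G : Type*} [Group G] (Q K : Subgroup G) :
    Q.relIndex K = ((fun k : G => (k : G ⧸ Q)) '' (K : Set G)).ncard := by
  have h1 : MulAction.stabilizer K ((1 : G) : G ⧸ Q) = Q.subgroupOf K := by
    ext k
    rw [MulAction.mem_stabilizer_iff, Subgroup.mem_subgroupOf]
    change ((((k : G) * 1 : G) : G ⧸ Q) = ((1 : G) : G ⧸ Q)) ↔ _
    rw [mul_one, eq_comm, QuotientGroup.eq, inv_one, one_mul]
  have h2 : MulAction.orbit K ((1 : G) : G ⧸ Q) = (fun k : G => (k : G ⧸ Q)) '' (K : Set G) := by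
    ext x
    constructor
    · rintro ⟨k, rfl⟩
      refine ⟨k, k.2, ?_⟩
      change ((k : G) : G ⧸ Q) = (((k : G) * 1 : G) : G ⧸ Q)
      rw [mul_one]
    · rintro ⟨k, hk, rfl⟩
      refine ⟨⟨k, hk⟩, ?_⟩
      change ((k * 1 : G) : G ⧸ Q) = _
      rw [mul_one]
  rw [Subgroup.relIndex, ← h1, MulAction.index_stabilizer, h2]

theorem Subgroup.finite_image_of_relIndex_ne_zero {G : Type*} [Group G] {Q K : Subgroup G}
    (h : Q.relIndex K ≠ 0) : ((fun k : G => (k : G ⧸ Q)) '' (K : Set G)).Finite := by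
  rw [Subgroup.relIndex_eq_ncard_image] at h
  exact Set.finite_of_ncard_ne_zero h

/-- If `K ⊆ H * Q` then `K` meets at most as many cosets of `Q` as `H` does. -/
theorem Subgroup.relIndex_le_of_forall_exists {G : Type*} [Group G] {H K Q : Subgroup G}
    (h0 : Q.relIndex H ≠ 0) (h : ∀ k ∈ K, ∃ h ∈ H, h⁻¹ * k ∈ Q) :
    Q.relIndex K ≤ Q.relIndex H := by
  rw [Subgroup.relIndex_eq_ncard_image Q K, Subgroup.relIndex_eq_ncard_image Q H]
  refine Set.ncard_le_ncard ?_ (Subgroup.finite_image_of_relIndex_ne_zero h0)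
  rintro _ ⟨k, hk, rfl⟩
  obtain ⟨x, hx, hxk⟩ := h k hk
  exact ⟨x, hx, QuotientGroup.eq.mpr hxk⟩

/-- If `H ≤ K` meets as many cosets of `Q` as `K` does, then `K ⊆ H * Q`. -/
theorem Subgroup.exists_of_relIndex_le {G : Type*} [Group G] {H K Q : Subgroup G}
    (hHK : H ≤ K) (h0 : Q.relIndex K ≠ 0) (h : Q.relIndex K ≤ Q.relIndex H) {k : G}
    (hk : k ∈ K) : ∃ h ∈ H, h⁻¹ * k ∈ Q := by
  rw [Subgroup.relIndex_eq_ncard_image Q K, Subgroup.relIndex_eq_ncard_image Q H] at h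
  have e := Set.eq_of_subset_of_ncard_le (Set.image_mono hHK) h
    (Subgroup.finite_image_of_relIndex_ne_zero h0)
  have hk' : (k : G ⧸ Q) ∈ (fun k : G => (k : G ⧸ Q)) '' (K : Set G) := ⟨k, hk, rfl⟩
  rw [← e] at hk'
  obtain ⟨x, hx, hxk⟩ := hk'
  exact ⟨x, hx, QuotientGroup.eq.mp hxk⟩

/-- If `K = (H ⊓ K) * (K ⊓ L)`, both sides are the index of `H ⊓ K ⊓ L` in `H`, counted through
`H ⊓ L` and through `H ⊓ K`. -/
theorem Subgroup.relIndex_mul_relIndex_of_forall_exists {G : Type*} [Group G] {H K L : Subgroup G}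
    (h0 : L.relIndex K ≠ 0) (h : ∀ k ∈ K, ∃ h ∈ H ⊓ K, h⁻¹ * k ∈ L) :
    K.relIndex (H ⊓ L) * L.relIndex H = K.relIndex H * L.relIndex K := by
  have h1 : L.relIndex K = L.relIndex (H ⊓ K) := by
    apply le_antisymm
    · exact relIndex_le_of_forall_exists
        (fun h => h0 (Subgroup.relIndex_eq_zero_of_le_right inf_le_right h)) h
    · exact Subgroup.relIndex_le_of_le_right inf_le_right h0
  rw [h1, inf_comm H L, Subgroup.relIndex_inf_mul_relIndex, inf_comm H K, mul_comm,
    Subgroup.relIndex_inf_mul_relIndex, inf_comm]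

/-! ### The stabilizer of an interval -/

section interval

variable {G : Type*} [Group G]

/-- For subgroups `A`, `Q`, `B`, the left cosets of `Q` which meet both `A` and `B`; the value is
their union, as a subset of the group. -/
def cosetInterval (A Q B : Subgroup G) : Set G :=
  {x | (∃ a ∈ A, a⁻¹ * x ∈ Q) ∧ ∃ b ∈ B, b⁻¹ * x ∈ Q}

open Pointwise in
/-- The subgroup of all `g` with `g * C = C`, where `C = cosetInterval A Q B`. -/
def intervalStab (A Q B : Subgroup G) : Subgroup G :=
  MulAction.stabilizer G (cosetInterval A Q B)

theorem mem_intervalStab {A Q B : Subgroup G} {g : G} :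
    g ∈ intervalStab A Q B ↔ ∀ x, g * x ∈ cosetInterval A Q B ↔ x ∈ cosetInterval A Q B :=
  MulAction.mem_stabilizer_set

theorem inf_le_intervalStab (A Q B : Subgroup G) : A ⊓ B ≤ intervalStab A Q B := by
  rintro g ⟨hA, hB⟩
  rw [mem_intervalStab]
  have key : ∀ (g x : G) (D : Subgroup G), g ∈ D → (∃ a ∈ D, a⁻¹ * x ∈ Q) →
      ∃ a ∈ D, a⁻¹ * (g * x) ∈ Q := by
    rintro g x D hg ⟨a, ha, hax⟩
    refine ⟨g * a, D.mul_mem hg ha, ?_⟩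
    convert hax using 1
    group
  intro x
  constructor
  · rintro ⟨h1, h2⟩
    have := key g⁻¹ _ A (A.inv_mem hA) h1
    have := key g⁻¹ _ B (B.inv_mem hB) h2
    rw [inv_mul_cancel_left] at *
    exact ⟨by assumption, by assumption⟩
  · rintro ⟨h1, h2⟩
    exact ⟨key g x A hA h1, key g x B hB h2⟩

theorem intervalStab_subset (A Q B : Subgroup G) :
    (intervalStab A Q B : Set G) ⊆ cosetInterval A Q B := by
  intro g hg
  have h1 : (1 : G) ∈ cosetInterval A Q B :=
    ⟨⟨1, A.one_mem, by simp⟩, ⟨1, B.one_mem, by simp⟩⟩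
  simpa using (mem_intervalStab.mp hg 1).mpr h1

theorem map_intervalStab (α : MulAut G) (A Q B : Subgroup G) :
    (intervalStab A Q B).map α.toMonoidHom =
      intervalStab (A.map α.toMonoidHom) (Q.map α.toMonoidHom) (B.map α.toMonoidHom) := by
  have hm : ∀ (D : Subgroup G) (x : G), α x ∈ D.map α.toMonoidHom ↔ x ∈ D := fun D x =>
    Subgroup.mem_map_iff_mem α.injective
  have hc : ∀ x : G, α x ∈ cosetInterval (A.map α.toMonoidHom) (Q.map α.toMonoidHom)
      (B.map α.toMonoidHom) ↔ x ∈ cosetInterval A Q B := by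
    intro x
    have h1 : ∀ D : Subgroup G, (∃ a ∈ D.map α.toMonoidHom, a⁻¹ * α x ∈ Q.map α.toMonoidHom) ↔
        ∃ a ∈ D, a⁻¹ * x ∈ Q := by
      intro D
      constructor
      · rintro ⟨_, ⟨a, ha, rfl⟩, h⟩
        refine ⟨a, ha, ?_⟩
        rw [← hm Q, map_mul, map_inv]
        exact h
      · rintro ⟨a, ha, h⟩
        refine ⟨α a, (hm D a).mpr ha, ?_⟩
        rw [← map_inv, ← map_mul]
        exact (hm Q _).mpr h
    exact and_congr (h1 A) (h1 B)
  ext g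
  obtain ⟨g, rfl⟩ := α.surjective g
  rw [hm, mem_intervalStab, mem_intervalStab]
  constructor
  · intro h x
    obtain ⟨x, rfl⟩ := α.surjective x
    rw [← map_mul, hc, hc, h]
  · intro h x
    rw [← hc, ← hc x, map_mul, h]

theorem mem_cosetInterval_iff {A Q B : Subgroup G} (h : ∀ g ∈ Q, ∃ h ∈ A ⊓ Q, h⁻¹ * g ∈ B) {x : G} :
    x ∈ cosetInterval A Q B ↔ ∃ p ∈ A ⊓ B, p⁻¹ * x ∈ Q := by
  constructor
  · rintro ⟨⟨a, ha, hax⟩, b, hb, hbx⟩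
    obtain ⟨y, ⟨hyA, hyQ⟩, hyB⟩ := h (a⁻¹ * b) (by
      have := Q.mul_mem hax (Q.inv_mem hbx)
      convert this using 1
      group)
    refine ⟨a * y, Subgroup.mem_inf.mpr ⟨A.mul_mem ha hyA, ?_⟩, ?_⟩
    · have := B.mul_mem hb (B.inv_mem hyB)
      convert this using 1
      group
    · have := Q.mul_mem (Q.inv_mem hyQ) hax
      convert this using 1
      group
  · rintro ⟨p, ⟨hpA, hpB⟩, hpx⟩
    exact ⟨⟨p, hpA, hpx⟩, p, hpB, hpx⟩

/-- As `cosetInterval A Q B` is a finite union of cosets of `Q`, it is enough that left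
multiplication by `g` maps it into itself. -/
theorem mem_intervalStab_of_forall {A Q B : Subgroup G} (h0 : Q.relIndex A ≠ 0) {g : G}
    (h : ∀ x ∈ cosetInterval A Q B, g * x ∈ cosetInterval A Q B) : g ∈ intervalStab A Q B := by
  set S : Set (G ⧸ Q) := (fun x : G => (x : G ⧸ Q)) '' cosetInterval A Q B with hS
  have hSmem : ∀ x : G, (x : G ⧸ Q) ∈ S → x ∈ cosetInterval A Q B := by
    rintro x ⟨y, ⟨⟨a, ha, hay⟩, b, hb, hby⟩, hyx⟩
    have hyx' : y⁻¹ * x ∈ Q := QuotientGroup.eq.mp hyx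
    refine ⟨⟨a, ha, ?_⟩, b, hb, ?_⟩
    · convert Q.mul_mem hay hyx' using 1
      group
    · convert Q.mul_mem hby hyx' using 1
      group
  have hfin : S.Finite := by
    refine (Subgroup.finite_image_of_relIndex_ne_zero h0).subset ?_
    rintro _ ⟨x, ⟨⟨a, ha, hax⟩, -⟩, rfl⟩
    exact ⟨a, ha, QuotientGroup.eq.mpr hax⟩
  have hmaps : (fun s : G ⧸ Q => g • s) '' S ⊆ S := by
    rintro _ ⟨_, ⟨x, hx, rfl⟩, rfl⟩
    exact ⟨g * x, h x hx, rfl⟩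
  have heq := Set.eq_of_subset_of_ncard_le hmaps
    (Set.ncard_image_of_injective S (MulAction.injective g)).ge hfin
  rw [mem_intervalStab]
  refine fun x => ⟨fun hx => ?_, h x⟩
  have hx' : ((g * x : G) : G ⧸ Q) ∈ S := ⟨_, hx, rfl⟩
  rw [← heq] at hx'
  obtain ⟨s, hs, hsx⟩ := hx'
  have : s = (x : G ⧸ Q) := MulAction.injective g hsx
  exact hSmem x (this ▸ hs)

variable {O₀ O₁ O₂ O₃ : Subgroup G}

/-- Cosets of `O₀, …, O₃` are regarded as the vertices on four consecutive levels of a directed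
graph, in which two cosets on adjacent levels are joined if they meet. The transitivity hypotheses
say that paths can be extended by stabilizers of paths, `hD₁` and `hD₂` that an interval does
not grow when its end is moved by one level. Then the stabilizers `V` and `V'` of two successive
intervals satisfy `|V : V ∩ V'| * D ≤ |O₂ : O₂ ∩ O₃|`, where `D = |O₀ ∩ O₃ : O₀ ∩ O₂ ∩ O₃|` is the
size of an interval, provided that the orbits of `O₂` under `V` and of `O₃` under `V'` have the same
size. The proof counts the orbit of the edge from `O₂` to `O₃` under `V` in two ways. -/
theorem relIndex_intervalStab_mul_le
    (fwd₁ : ∀ g ∈ O₁, ∃ h ∈ O₀ ⊓ O₁, h⁻¹ * g ∈ O₂)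
    (fwd₂ : ∀ g ∈ O₂, ∃ h ∈ O₀ ⊓ O₁ ⊓ O₂, h⁻¹ * g ∈ O₃)
    (bwd₂ : ∀ g ∈ O₁, ∃ h ∈ O₁ ⊓ O₂ ⊓ O₃, h⁻¹ * g ∈ O₀)
    (n₁ : O₁.relIndex O₀ ≠ 0) (n₂ : O₂.relIndex O₁ ≠ 0) (n₃ : O₂.relIndex O₃ ≠ 0)
    (n₄ : O₃.relIndex O₂ ≠ 0)
    (m₂ : O₂.relIndex (intervalStab O₀ O₁ O₂) ≠ 0)
    (m₃ : O₃.relIndex (intervalStab O₀ O₁ O₂) ≠ 0)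
    (hD₁ : O₁.relIndex (O₀ ⊓ O₃) ≤ O₁.relIndex (O₀ ⊓ O₂))
    (hD₂ : O₂.relIndex (O₀ ⊓ O₃) ≤ O₂.relIndex (O₁ ⊓ O₃)) :
    (intervalStab O₁ O₂ O₃).relIndex (intervalStab O₀ O₁ O₂) *
        O₃.relIndex (intervalStab O₁ O₂ O₃) * O₂.relIndex (O₀ ⊓ O₃) ≤
      O₂.relIndex (intervalStab O₀ O₁ O₂) * O₃.relIndex O₂ := by
  have fin : ∀ {Q H K : Subgroup G}, Q.relIndex K ≠ 0 → H ≤ K → Q.relIndex H ≠ 0 :=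
    fun h hle h' => h (Subgroup.relIndex_eq_zero_of_le_right hle h')
  have e₁ : ∀ p ∈ O₀ ⊓ O₃, ∃ p' ∈ O₀ ⊓ O₂ ⊓ O₃, p'⁻¹ * p ∈ O₁ := by
    have : O₁.relIndex (O₀ ⊓ O₂) ≤ O₁.relIndex (O₀ ⊓ O₂ ⊓ O₃) := by
      refine Subgroup.relIndex_le_of_forall_exists
        (fin n₁ (inf_le_left.trans inf_le_left)) fun p hp => ?_
      obtain ⟨h, ⟨⟨h0, h1⟩, h2⟩, h3⟩ := fwd₂ p⁻¹ (O₂.inv_mem hp.2)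
      refine ⟨p * h, ⟨⟨O₀.mul_mem hp.1 h0, O₂.mul_mem hp.2 h2⟩, ?_⟩, ?_⟩
      · simpa using O₃.inv_mem h3
      · simpa using h1
    exact fun p hp => Subgroup.exists_of_relIndex_le (inf_le_inf_right _ inf_le_left)
      (fin n₁ inf_le_left) (hD₁.trans this) hp
  have e₂ : ∀ p ∈ O₀ ⊓ O₃, ∃ p' ∈ O₀ ⊓ O₁ ⊓ O₃, p'⁻¹ * p ∈ O₂ := by
    have : O₂.relIndex (O₁ ⊓ O₃) ≤ O₂.relIndex (O₀ ⊓ O₁ ⊓ O₃) := by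
      refine Subgroup.relIndex_le_of_forall_exists
        (fin n₃ inf_le_right) fun p hp => ?_
      obtain ⟨h, ⟨⟨h1, h2⟩, h3⟩, h0⟩ := bwd₂ p⁻¹ (O₁.inv_mem hp.1)
      refine ⟨p * h, ⟨⟨?_, O₁.mul_mem hp.1 h1⟩, O₃.mul_mem hp.2 h3⟩, ?_⟩
      · simpa using O₀.inv_mem h0
      · simpa using h2
    exact fun p hp => Subgroup.exists_of_relIndex_le (inf_le_inf_right _ inf_le_left)
      (fin n₃ inf_le_right) (hD₂.trans this) hp
  -- `O₀ ⊓ O₃` acts transitively on both intervals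
  have c₁ : ∀ p ∈ O₀ ⊓ O₃, p ∈ intervalStab O₀ O₁ O₂ := by
    have key : ∀ x, x ∈ cosetInterval O₀ O₁ O₂ ↔ ∃ p ∈ O₀ ⊓ O₃, p⁻¹ * x ∈ O₁ := by
      intro x
      rw [mem_cosetInterval_iff fwd₁]
      constructor
      · rintro ⟨p, ⟨hp0, hp2⟩, hpx⟩
        obtain ⟨h, ⟨⟨h0, h1⟩, h2⟩, h3⟩ := fwd₂ p⁻¹ (O₂.inv_mem hp2)
        refine ⟨p * h, ⟨O₀.mul_mem hp0 h0, by simpa using O₃.inv_mem h3⟩, ?_⟩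
        convert O₁.mul_mem (O₁.inv_mem h1) hpx using 1
        group
      · rintro ⟨p, hp, hpx⟩
        obtain ⟨p', hp', hpp'⟩ := e₁ p hp
        refine ⟨p', hp'.1, ?_⟩
        convert O₁.mul_mem hpp' hpx using 1
        group
    intro p hp
    refine mem_intervalStab_of_forall n₁ fun x hx => ?_
    obtain ⟨r, hr, hrx⟩ := (key x).mp hx
    refine (key _).mpr ⟨p * r, mul_mem hp hr, ?_⟩
    convert hrx using 1
    group
  have c₂ : ∀ x ∈ cosetInterval O₁ O₂ O₃, ∃ p ∈ O₀ ⊓ O₃, p⁻¹ * x ∈ O₂ := by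
    intro x hx
    rw [mem_cosetInterval_iff (fun g hg => by
      obtain ⟨h, ⟨⟨h0, h1⟩, h2⟩, h3⟩ := fwd₂ g hg
      exact ⟨h, ⟨h1, h2⟩, h3⟩)] at hx
    obtain ⟨p, ⟨hp1, hp3⟩, hpx⟩ := hx
    obtain ⟨h, ⟨⟨h1, h2⟩, h3⟩, h0⟩ := bwd₂ p⁻¹ (O₁.inv_mem hp1)
    refine ⟨p * h, ⟨by simpa using O₀.inv_mem h0, O₃.mul_mem hp3 h3⟩, ?_⟩
    convert O₂.mul_mem (O₂.inv_mem h2) hpx using 1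
    group
  -- every vertex of the first interval is joined to every vertex of the second
  have join : ∀ c ∈ cosetInterval O₀ O₁ O₂, ∀ u ∈ cosetInterval O₁ O₂ O₃,
      ∃ a ∈ O₁, a⁻¹ * (c⁻¹ * u) ∈ O₂ := by
    intro c hc u hu
    obtain ⟨p, hp, hpu⟩ := c₂ u hu
    obtain ⟨-, b, hb, hbc⟩ := (mem_intervalStab.mp (inv_mem (c₁ p hp)) c).mpr hc
    refine ⟨c⁻¹ * p * b, ?_, ?_⟩
    · convert O₁.inv_mem hbc using 1
      group
    · convert O₂.mul_mem (O₂.inv_mem hb) hpu using 1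
      group
  have hle : intervalStab O₀ O₁ O₂ ⊓ O₃ ≤ intervalStab O₁ O₂ O₃ := by
    rintro g ⟨hgV, hg3⟩
    refine mem_intervalStab_of_forall n₂ fun x hx => ⟨?_, ?_⟩
    · simpa using join g⁻¹ (intervalStab_subset _ _ _ (inv_mem hgV)) x hx
    · obtain ⟨-, b, hb, hbx⟩ := hx
      refine ⟨g * b, O₃.mul_mem hg3 hb, ?_⟩
      convert hbx using 1
      group
  have htrans : ∀ g ∈ intervalStab O₁ O₂ O₃,
      ∃ h ∈ intervalStab O₀ O₁ O₂ ⊓ intervalStab O₁ O₂ O₃, h⁻¹ * g ∈ O₃ := by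
    intro g hg
    obtain ⟨-, b, hb, hbg⟩ := intervalStab_subset _ _ _ (inv_mem hg)
    obtain ⟨h, ⟨⟨h0, h1⟩, h2⟩, h3⟩ := fwd₂ (g * b) (by simpa using O₂.inv_mem hbg)
    have h3' : h⁻¹ * g ∈ O₃ := by
      convert O₃.mul_mem h3 (O₃.inv_mem hb) using 1
      group
    refine ⟨h, Subgroup.mem_inf.mpr ⟨inf_le_intervalStab _ _ _ ⟨h0, h2⟩, ?_⟩, h3'⟩
    rw [← inv_mem_iff]
    refine mem_intervalStab_of_forall n₂ fun u hu => ⟨?_, ?_⟩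
    · obtain ⟨⟨a, ha, hau⟩, -⟩ := hu
      refine ⟨h⁻¹ * a, O₁.mul_mem (O₁.inv_mem h1) ha, ?_⟩
      convert hau using 1
      group
    · obtain ⟨-, d, hd, hdu⟩ := (mem_intervalStab.mp (inv_mem hg) u).mpr hu
      refine ⟨h⁻¹ * g * d, O₃.mul_mem h3' hd, ?_⟩
      convert hdu using 1
      group
  set V := intervalStab O₀ O₁ O₂ with hV
  set V' := intervalStab O₁ O₂ O₃ with hV'
  have i₁ : (O₂ ⊓ O₃).relIndex V ≤ O₂.relIndex V * O₃.relIndex O₂ := by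
    rw [inf_comm, ← Subgroup.relIndex_inf_mul_relIndex, mul_comm]
    exact Nat.mul_le_mul_left _ (Subgroup.relIndex_le_of_le_right inf_le_left n₄)
  have i₂ : O₃.relIndex V = O₃.relIndex (V ⊓ V') * V'.relIndex V := by
    rw [inf_comm V, Subgroup.relIndex_inf_mul_relIndex, ← Subgroup.inf_relIndex_right,
      ← Subgroup.inf_relIndex_right (O₃ ⊓ V')]
    congr 1
    apply le_antisymm
    · exact le_inf (le_inf inf_le_left (inf_comm O₃ V ▸ hle)) inf_le_right
    · exact inf_le_inf_right _ inf_le_left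
  have i₃ : O₃.relIndex V' ≤ O₃.relIndex (V ⊓ V') :=
    Subgroup.relIndex_le_of_forall_exists (fin m₃ inf_le_left) htrans
  have i₄ : O₂.relIndex (O₀ ⊓ O₃) ≤ O₂.relIndex (O₃ ⊓ V) :=
    Subgroup.relIndex_le_of_le_right (le_inf inf_le_right c₁) (fin m₂ inf_le_right)
  calc V'.relIndex V * O₃.relIndex V' * O₂.relIndex (O₀ ⊓ O₃)
      ≤ V'.relIndex V * O₃.relIndex (V ⊓ V') * O₂.relIndex (O₃ ⊓ V) := by gcongr
    _ = O₂.relIndex (O₃ ⊓ V) * O₃.relIndex V := by rw [i₂]; ring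
    _ = (O₂ ⊓ O₃).relIndex V := Subgroup.relIndex_inf_mul_relIndex _ _ _
    _ ≤ _ := i₁

end interval

/-! ### Powers of an automorphism and a common tidy subgroup -/

namespace CompactOpenSubgroup

variable {G : Type*} [Group G] [TopologicalSpace G] [IsTopologicalGroup G]

/-- The intersection of two compact open subgroups. -/
def inf (V W : CompactOpenSubgroup G) : CompactOpenSubgroup G :=
  ⟨V.1 ⊓ W.1, V.2.1.inter_right (W.1.isClosed_of_isOpen W.2.2), V.2.2.inter W.2.2⟩

/-- `intervalStab` for compact open subgroups: it is open as it contains `A ⊓ B`, and compact as it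
lies in the compact set `A * Q`. -/
def interval (A Q B : CompactOpenSubgroup G) : CompactOpenSubgroup G :=
  ⟨intervalStab A.1 Q.1 B.1, by
    have ho : IsOpen (intervalStab A.1 Q.1 B.1 : Set G) :=
      Subgroup.isOpen_mono (inf_le_intervalStab A.1 Q.1 B.1) (A.2.2.inter B.2.2)
    refine ⟨?_, ho⟩
    refine (A.2.1.mul Q.2.1).of_isClosed_subset (Subgroup.isClosed_of_isOpen _ ho) ?_
    intro x hx
    obtain ⟨⟨a, ha, hax⟩, -⟩ := intervalStab_subset _ _ _ hx
    exact ⟨a, ha, a⁻¹ * x, hax, by simp⟩⟩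

end CompactOpenSubgroup

namespace BicontAut

open CompactOpenSubgroup

variable {G : Type*} [Group G] [TopologicalSpace G]

theorem apply_mem_smul {α : BicontAut G} {V : CompactOpenSubgroup G} {g : G} :
    α.1 g ∈ (α • V).1 ↔ g ∈ V.1 :=
  Subgroup.mem_map_iff_mem α.1.injective

theorem inv_apply_mem_inv_smul {α : BicontAut G} {V : CompactOpenSubgroup G} {g : G} :
    α.1⁻¹ g ∈ V.1 ↔ g ∈ (α • V).1 := by
  rw [← apply_mem_smul (α := α), MulAut.apply_inv_self]

/-- The index `|O : O ∩ α^k(O)|`. -/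
noncomputable def powIdx (O : CompactOpenSubgroup G) (α : BicontAut G) (k : ℕ) : ℕ :=
  O.idx (α ^ k • O)

/-- The index `|O ∩ α^k(O) : O ∩ α^i(O) ∩ α^k(O)|`. -/
noncomputable def gapIdx (O : CompactOpenSubgroup G) (α : BicontAut G) (i k : ℕ) : ℕ :=
  (α ^ i • O).1.relIndex (O.1 ⊓ (α ^ k • O).1)

theorem idx_pow_add (O : CompactOpenSubgroup G) (α : BicontAut G) (i k : ℕ) :
    (α ^ i • O).idx (α ^ (i + k) • O) = powIdx O α k := by
  rw [pow_add, mul_smul, idx_smul, powIdx]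

theorem powIdx_pow (O : CompactOpenSubgroup G) (α : BicontAut G) (k l : ℕ) :
    powIdx O (α ^ k) l = powIdx O α (k * l) := by
  rw [powIdx, powIdx, pow_mul]

variable [IsTopologicalGroup G]

theorem IsTidy.idx_le {O : CompactOpenSubgroup G} {α : BicontAut G} (h : IsTidy O α)
    (V : CompactOpenSubgroup G) : O.idx (α • O) ≤ V.idx (α • V) := by
  have key : ∀ W : CompactOpenSubgroup G, (α⁻¹ • W).idx W = W.idx (α • W) := fun W => by
    rw [← idx_smul α, smul_inv_smul]
  rw [← key, ← key, ← scale_eq_of_isTidy h.inv]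
  exact Nat.sInf_le ⟨V, rfl⟩

/-- The intersection of `α^i(O)` over `0 ≤ i ≤ n`. -/
def infPow (α : BicontAut G) (O : CompactOpenSubgroup G) : ℕ → CompactOpenSubgroup G
  | 0 => O
  | n + 1 => (infPow α O n).inf (α ^ (n + 1) • O)

theorem mem_infPow {α : BicontAut G} {O : CompactOpenSubgroup G} {n : ℕ} {g : G} :
    g ∈ (infPow α O n).1 ↔ ∀ i ≤ n, g ∈ (α ^ i • O).1 := by
  induction n with
  | zero => simp [infPow]
  | succ n ih =>
    change g ∈ (infPow α O n).1 ∧ g ∈ (α ^ (n + 1) • O).1 ↔ _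
    rw [ih]
    constructor
    · rintro ⟨h1, h2⟩ i hi
      rcases Nat.of_le_succ hi with h | rfl
      · exact h1 i h
      · exact h2
    · exact fun h => ⟨fun i hi => h i (by omega), h _ le_rfl⟩

/-- If `O` is tidy for `α`, then every element of `α^n(O)` is the product of an element of the
intersection of the `α^i(O)`, `0 ≤ i ≤ n`, and an element of `α^(n+1)(O)`: otherwise the
intersection would have a smaller displacement than `O`. -/
theorem IsTidy.exists_forall_mem {O : CompactOpenSubgroup G} {α : BicontAut G} (h : IsTidy O α)
    (n : ℕ) {g : G} (hg : g ∈ (α ^ n • O).1) :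
    ∃ y, (∀ i ≤ n, y ∈ (α ^ i • O).1) ∧ y⁻¹ * g ∈ (α ^ (n + 1) • O).1 := by
  have h1 := h.idx_le (infPow α O n)
  have h2 : (infPow α O n).idx (α • infPow α O n) = (infPow α O n).idx (α ^ (n + 1) • O) := by
    rw [idx, idx, ← Subgroup.inf_relIndex_left (infPow α O n).1 (α • infPow α O n).1,
      ← Subgroup.inf_relIndex_left (infPow α O n).1 (α ^ (n + 1) • O).1]
    congr 1
    ext x
    rw [Subgroup.mem_inf, Subgroup.mem_inf, and_congr_right_iff]
    intro hx
    rw [← inv_apply_mem_inv_smul, mem_infPow]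
    have e : ∀ i : ℕ, α.1⁻¹ x ∈ (α ^ i • O).1 ↔ x ∈ (α ^ (i + 1) • O).1 := fun i => by
      rw [inv_apply_mem_inv_smul, smul_smul, ← pow_succ']
    simp only [e]
    refine ⟨fun h => h n le_rfl, fun h i hi => ?_⟩
    rcases hi.lt_or_eq with h' | rfl
    · exact mem_infPow.mp hx _ h'
    · exact h
  have h3 : (α ^ n • O).idx (α ^ (n + 1) • O) = O.idx (α • O) := by
    rw [pow_succ, mul_smul, idx_smul]
  rw [h2, ← h3] at h1
  obtain ⟨y, hy, hyg⟩ := Subgroup.exists_of_relIndex_le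
    (fun x hx => mem_infPow.mp hx n le_rfl) (idx_ne_zero _ _) h1 hg
  exact ⟨y, mem_infPow.mp hy, hyg⟩

/-- The counterpart of `IsTidy.exists_forall_mem` for `α⁻¹`, moved by `α^(n+1)`. -/
theorem IsTidy.exists_forall_mem' {O : CompactOpenSubgroup G} {α : BicontAut G} (h : IsTidy O α)
    (n : ℕ) {g : G} (hg : g ∈ (α • O).1) :
    ∃ y, (∀ i, 1 ≤ i → i ≤ n + 1 → y ∈ (α ^ i • O).1) ∧ y⁻¹ * g ∈ O.1 := by
  have e : ∀ i ≤ n + 1, ∀ x, (α ^ (n + 1)).1 x ∈ (α ^ (n + 1 - i) • O).1 ↔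
      x ∈ (α⁻¹ ^ i • O).1 := by
    intro i hi x
    rw [← apply_mem_smul (α := α ^ (n + 1)) (V := α⁻¹ ^ i • O), smul_smul]
    rw [show α ^ (n + 1) * α⁻¹ ^ i = α ^ (n + 1 - i) by
      rw [inv_pow, ← pow_sub _ hi]]
  obtain ⟨g, rfl⟩ := (α ^ (n + 1)).1.surjective g
  obtain ⟨y, hy, hyg⟩ := h.inv.exists_forall_mem n (g := g) (by
    rw [← e n (by omega), Nat.add_sub_cancel_left, pow_one]
    exact hg)
  refine ⟨(α ^ (n + 1)).1 y, fun i h1 h2 => ?_, ?_⟩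
  · have := (e (n + 1 - i) (by omega) y).mpr (hy _ (by omega))
    rwa [Nat.sub_sub_self h2] at this
  · rw [← map_inv, ← map_mul]
    have := (e (n + 1) le_rfl _).mpr hyg
    rwa [Nat.sub_self, pow_zero, one_smul] at this

theorem powIdx_pos (O : CompactOpenSubgroup G) (α : BicontAut G) (k : ℕ) : 0 < powIdx O α k :=
  idx_pos _ _

/-- By transitivity on paths, `|O : O ∩ α^i(O) ∩ α^k(O)|` is the product of `|O : O ∩ α^i(O)|` and
`|α^i(O) : α^i(O) ∩ α^k(O)|`. -/
theorem IsTidy.gapIdx_mul_powIdx {O : CompactOpenSubgroup G} {α : BicontAut G} (h : IsTidy O α)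
    {i k : ℕ} (hik : i ≤ k) :
    gapIdx O α i k * powIdx O α k = powIdx O α i * powIdx O α (k - i) := by
  have key : ∀ j, ∀ g ∈ (α ^ i • O).1, ∃ y, (∀ l ≤ i, y ∈ (α ^ l • O).1) ∧
      y⁻¹ * g ∈ (α ^ (i + j) • O).1 := by
    intro j
    induction j with
    | zero => exact fun g hg => ⟨1, fun l _ => one_mem _, by simpa using hg⟩
    | succ j ih =>
      intro g hg
      obtain ⟨y, hy, hyg⟩ := ih g hg
      obtain ⟨z, hz, hzg⟩ := h.exists_forall_mem (i + j) hyg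
      refine ⟨y * z, fun l hl => mul_mem (hy l hl) (hz l (by omega)), ?_⟩
      rw [mul_inv_rev, mul_assoc]
      exact hzg
  have h1 := Subgroup.relIndex_mul_relIndex_of_forall_exists (H := O.1) (K := (α ^ i • O).1)
    (L := (α ^ k • O).1) (idx_ne_zero (α ^ i • O) (α ^ k • O)) (fun g hg => by
      obtain ⟨y, hy, hyg⟩ := key (k - i) g hg
      rw [Nat.add_sub_of_le hik] at hyg
      exact ⟨y, Subgroup.mem_inf.mpr ⟨by simpa using hy 0 (Nat.zero_le _), hy i le_rfl⟩, hyg⟩)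
  refine h1.trans ?_
  rw [← idx_pow_add O α i (k - i), Nat.add_sub_of_le hik]
  rfl

/-- If `O` is tidy for `α`, and `|O : O ∩ α^k(O)|` is a geometric progression for `k = 1, 2, 3`,
then it is so from `k = 0` on: otherwise the stabilizer of an interval would have a smaller
displacement than `O`. -/
theorem IsTidy.powIdx_two {O : CompactOpenSubgroup G} {α : BicontAut G} (h : IsTidy O α)
    (hgeom : powIdx O α 2 ^ 2 = powIdx O α 1 * powIdx O α 3) :
    powIdx O α 2 = powIdx O α 1 ^ 2 := by
  have g12 := h.gapIdx_mul_powIdx (i := 1) (k := 2) (by norm_num)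
  have g13 := h.gapIdx_mul_powIdx (i := 1) (k := 3) (by norm_num)
  have g23 := h.gapIdx_mul_powIdx (i := 2) (k := 3) (by norm_num)
  norm_num at g12 g13 g23
  have p1 := powIdx_pos O α 1
  have p2 := powIdx_pos O α 2
  have p3 := powIdx_pos O α 3
  -- intervals over two and over three steps have the same number of vertices on each level
  have e1 : gapIdx O α 1 3 = gapIdx O α 1 2 := by
    apply Nat.eq_of_mul_eq_mul_right (Nat.mul_pos p2 p3)
    linear_combination powIdx O α 2 * g13 - powIdx O α 3 * g12 + powIdx O α 1 * hgeom
  have e2 : gapIdx O α 2 3 = gapIdx O α 1 2 := by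
    apply Nat.eq_of_mul_eq_mul_right (Nat.mul_pos p2 p3)
    linear_combination powIdx O α 2 * g23 - powIdx O α 3 * g12 + powIdx O α 1 * hgeom
  set V := interval O (α • O) (α ^ 2 • O) with hV
  have hαV : (α • V).1 = intervalStab (α • O).1 (α ^ 2 • O).1 (α ^ 3 • O).1 := by
    rw [coe_smul]
    refine (map_intervalStab _ _ _ _).trans ?_
    rw [← coe_smul, ← coe_smul, ← coe_smul, smul_smul, smul_smul, ← pow_two, ← pow_succ']
  have main := relIndex_intervalStab_mul_le (O₀ := O.1) (O₁ := (α • O).1) (O₂ := (α ^ 2 • O).1)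
    (O₃ := (α ^ 3 • O).1)
    (fun g hg => by
      obtain ⟨y, hy, hyg⟩ := h.exists_forall_mem 1 (g := g) (by rwa [pow_one])
      exact ⟨y, Subgroup.mem_inf.mpr ⟨by simpa using hy 0, by simpa using hy 1⟩, hyg⟩)
    (fun g hg => by
      obtain ⟨y, hy, hyg⟩ := h.exists_forall_mem 2 hg
      exact ⟨y, Subgroup.mem_inf.mpr ⟨Subgroup.mem_inf.mpr ⟨by simpa using hy 0,
        by simpa using hy 1⟩, hy 2 le_rfl⟩, hyg⟩)
    (fun g hg => by
      obtain ⟨y, hy, hyg⟩ := h.exists_forall_mem' 2 hg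
      exact ⟨y, Subgroup.mem_inf.mpr ⟨Subgroup.mem_inf.mpr ⟨by simpa using hy 1,
        hy 2 (by norm_num) (by norm_num)⟩, hy 3 (by norm_num) (by norm_num)⟩, hyg⟩)
    (idx_ne_zero _ _) (idx_ne_zero _ _) (idx_ne_zero _ _) (idx_ne_zero _ _)
    (idx_ne_zero V (α ^ 2 • O)) (idx_ne_zero V (α ^ 3 • O))
    (by
      simp only [gapIdx, pow_one] at e1
      exact e1.le)
    (by
      have e3 : gapIdx O α 1 2 = (α ^ 2 • O).1.relIndex ((α • O).1 ⊓ (α ^ 3 • O).1) := by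
        rw [gapIdx, pow_one, ← Subgroup.relIndex_map_map_of_injective (f := α.1.toMonoidHom) _ _
            α.1.injective, Subgroup.map_inf _ _ α.1.toMonoidHom α.1.injective,
            ← coe_smul, ← coe_smul, ← coe_smul,
          smul_smul, smul_smul, ← pow_two, ← pow_succ']
      exact (e2.trans e3).le)
  rw [← hαV] at main
  change V.idx (α • V) * (α • V).idx (α ^ 3 • O) * gapIdx O α 2 3 ≤
    V.idx (α ^ 2 • O) * (α ^ 2 • O).idx (α ^ 3 • O) at main
  rw [idx_pow_add O α 2 1, show α ^ 3 • O = α • (α ^ 2 • O) by rw [smul_smul, ← pow_succ'],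
    idx_smul, e2, powIdx, pow_one] at main
  have hmin := h.idx_le V
  have hD : gapIdx O α 1 2 ≤ 1 := by
    have q1 := idx_pos O (α • O)
    have q2 := idx_pos V (α ^ 2 • O)
    have : (V.idx (α ^ 2 • O) * O.idx (α • O)) * gapIdx O α 1 2 ≤
        (V.idx (α ^ 2 • O) * O.idx (α • O)) * 1 := by
      calc _ ≤ V.idx (α • V) * V.idx (α ^ 2 • O) * gapIdx O α 1 2 := by
            rw [mul_comm (V.idx (α ^ 2 • O))]
            gcongr
        _ ≤ _ := by rw [mul_one]; exact main
    exact Nat.le_of_mul_le_mul_left this (Nat.mul_pos q2 q1)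
  have hD' : gapIdx O α 1 2 ≠ 0 := fun h0 => by
    rw [h0, zero_mul] at g12
    exact (Nat.mul_pos p1 p1).ne g12
  rw [show gapIdx O α 1 2 = 1 by omega, one_mul] at g12
  rw [g12, pow_two]

/-- If `O` is tidy for all powers of `α`, then `|O : O ∩ α^k(O)| = |O : O ∩ α(O)|^k`. The ratios
`m k * m 1 / m (k + 1)`, where `m k = |O : O ∩ α^k(O)|`, form a nondecreasing sequence of integers;
its limit is shown to be `1` by applying `IsTidy.powIdx_two` to a high power of `α`. -/
theorem powIdx_eq_pow {O : CompactOpenSubgroup G} {α : BicontAut G}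
    (h : ∀ k : ℕ, IsTidy O (α ^ k)) (k : ℕ) : powIdx O α k = powIdx O α 1 ^ k := by
  have h1 : IsTidy O α := by simpa using h 1
  set d : ℕ → ℕ := fun k => gapIdx O α k (k + 1) with hd
  have hm : ∀ k, d k * powIdx O α (k + 1) = powIdx O α k * powIdx O α 1 := fun k => by
    have := h1.gapIdx_mul_powIdx (Nat.le_succ k)
    rwa [Nat.succ_sub (le_refl k), Nat.sub_self] at this
  have hmono : Monotone d := by
    refine monotone_nat_of_le_succ fun k => ?_
    have e : d k = (α ^ (k + 1) • O).1.relIndex ((α • O).1 ⊓ (α ^ (k + 2) • O).1) := by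
      rw [hd]
      change gapIdx O α k (k + 1) = _
      rw [gapIdx, ← Subgroup.relIndex_map_map_of_injective (f := α.1.toMonoidHom) _ _
          α.1.injective, Subgroup.map_inf _ _ α.1.toMonoidHom α.1.injective,
          ← coe_smul, ← coe_smul, ← coe_smul,
        smul_smul, smul_smul, ← pow_succ', ← pow_succ']
    have fin : (α ^ (k + 1) • O).1.relIndex (O.1 ⊓ (α ^ (k + 2) • O).1) ≠ 0 :=
      idx_ne_zero (O.inf (α ^ (k + 2) • O)) (α ^ (k + 1) • O)
    rw [e]
    refine Subgroup.relIndex_le_of_forall_exists fin fun g hg => ?_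
    obtain ⟨y, hy, hyg⟩ := h1.exists_forall_mem' (k + 1) (inv_mem hg.1)
    refine ⟨g * y, Subgroup.mem_inf.mpr ⟨by simpa using inv_mem hyg,
      mul_mem hg.2 (hy _ (by omega) (by omega))⟩, ?_⟩
    simpa using hy (k + 1) (by omega) (by omega)
  have hbound : ∀ k, d k ≤ (α • O).idx O := fun k => by
    have e : (α ^ (k + 1) • O).idx (α ^ k • O) = (α • O).idx O := by
      rw [pow_succ, mul_smul, idx_smul]
    rw [← e]
    exact Subgroup.relIndex_le_of_le_right inf_le_right (idx_ne_zero _ _)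
  obtain ⟨N, hN⟩ : ∃ N, ∀ k, N ≤ k → d k = d N := by
    obtain ⟨N, hN⟩ := (Set.Finite.subset (Set.finite_Iic ((α • O).idx O))
      (by rintro _ ⟨k, rfl⟩; exact hbound k : Set.range d ⊆ _)).exists_maximal
        (Set.range_nonempty d)
    obtain ⟨⟨N, rfl⟩, hmax⟩ := hN
    exact ⟨N, fun k hk => le_antisymm (hmax ⟨k, rfl⟩ (hmono hk)) (hmono hk)⟩
  set D := d N with hDdef
  set q := powIdx O α 1 with hq
  have hpos := powIdx_pos O α
  have hev : ∀ j k, N ≤ k → powIdx O α (k + j) * D ^ j = powIdx O α k * q ^ j := by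
    intro j k hk
    induction j with
    | zero => simp
    | succ j ih =>
      have := hm (k + j)
      rw [hN (k + j) (by omega)] at this
      calc _ = (D * powIdx O α (k + j + 1)) * D ^ j := by rw [← add_assoc]; ring
        _ = (powIdx O α (k + j) * D ^ j) * q := by rw [this]; ring
        _ = _ := by rw [ih]; ring
  have hD0 : 0 < D := by
    refine Nat.pos_of_ne_zero fun h0 => ?_
    have := hm N
    rw [← hDdef, h0, zero_mul] at this
    exact (Nat.mul_pos (hpos N) (hpos 1)).ne this
  -- the ratios are constant on multiples of `M`, so the geometric case applies to `α ^ M`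
  set M := N + 1 with hM
  have h2 := hev M M (by omega)
  have h3 := hev M (M + M) (by omega)
  have hgeo : powIdx O α (M + M) = powIdx O α M ^ 2 := by
    have := (h M).powIdx_two (by
      rw [powIdx_pow, powIdx_pow, powIdx_pow]
      rw [show M * 2 = M + M by ring, show M * 3 = M + M + M by ring, mul_one]
      apply Nat.eq_of_mul_eq_mul_right (Nat.mul_pos (Nat.pow_pos (n := M) hD0)
        (Nat.pow_pos (n := M) (hpos 1)))
      linear_combination powIdx O α (M + M) * q ^ M * h2 - powIdx O α M * q ^ M * h3)
    rwa [powIdx_pow, powIdx_pow, mul_one, show M * 2 = M + M by ring] at this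
  have hqM : q ^ M = powIdx O α M * D ^ M := by
    apply Nat.eq_of_mul_eq_mul_left (hpos M)
    rw [← h2, hgeo]
    ring
  have hle : ∀ k, q ^ (k + 1) ≤ powIdx O α (k + 1) * D ^ k := by
    intro k
    induction k with
    | zero => simp [hq]
    | succ k ih =>
      have hdk : d (k + 1) ≤ D := by
        rcases le_total (k + 1) N with hk | hk
        · exact hmono hk
        · exact (hN _ hk).le
      calc q ^ (k + 1 + 1) = q ^ (k + 1) * q := pow_succ _ _
        _ ≤ powIdx O α (k + 1) * D ^ k * q := by gcongr
        _ = (d (k + 1) * powIdx O α (k + 1 + 1)) * D ^ k := by rw [hm]; ring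
        _ ≤ (D * powIdx O α (k + 1 + 1)) * D ^ k := by gcongr
        _ = _ := by ring
  have hD1 : D ≤ 1 := by
    have := hle N
    rw [hqM, hM] at this
    have := Nat.le_of_mul_le_mul_left this (hpos _)
    rw [pow_succ] at this
    exact Nat.le_of_mul_le_mul_left (by rwa [mul_one]) (Nat.pow_pos (n := N) hD0)
  have hd1 : ∀ k, d k = 1 := fun k => by
    have hdk : d k ≤ D := by
      rcases le_total k N with hk | hk
      · exact hmono hk
      · exact (hN _ hk).le
    have : d k ≠ 0 := fun h0 => by
      have := hm k
      rw [h0, zero_mul] at this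
      exact (Nat.mul_pos (hpos k) (hpos 1)).ne this
    omega
  induction k with
  | zero => simp [powIdx, idx_self]
  | succ k ih =>
    have := hm k
    rw [hd1, one_mul] at this
    rw [this, ih, pow_succ]

/-- If `O` is tidy for all powers of `α`, then the displacement of `O` is homogeneous. -/
theorem dist_pow_smul {O : CompactOpenSubgroup G} {α : BicontAut G}
    (h : ∀ k : ℕ, IsTidy O (α ^ k)) (k : ℕ) :
    dist (α ^ k • O) O = k * dist (α • O) O := by
  have e : ∀ j : ℕ, (α ^ j • O).idx O = powIdx O α⁻¹ j := fun j => by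
    rw [powIdx, ← idx_smul (α ^ j) O, smul_smul, inv_pow, mul_inv_cancel, one_smul]
  have e1 := e 1
  rw [pow_one] at e1
  have h' : ∀ k : ℕ, IsTidy O (α⁻¹ ^ k) := fun k => by
    rw [inv_pow]
    exact (h k).inv
  have e2 : O.idx (α • O) = powIdx O α 1 := by rw [powIdx, pow_one]
  rw [dist_def, dist_def, e, e1, e2, show O.idx (α ^ k • O) = powIdx O α k from rfl,
    powIdx_eq_pow h, powIdx_eq_pow h', Nat.cast_pow, Nat.cast_pow, ← mul_pow, Real.log_pow]

end BicontAut

/-! ### Homogeneous length functions vanish on commutators -/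

/-- A conjugation invariant, symmetric, subadditive function on a group which is homogeneous on
powers. It may vanish at nontrivial elements. -/
structure IsHomogeneousLength {K : Type*} [Group K] (l : K → ℝ) : Prop where
  mul_le : ∀ g h, l (g * h) ≤ l g + l h
  inv : ∀ g, l g⁻¹ = l g
  conj : ∀ g h, l (h * g * h⁻¹) = l g
  pow : ∀ g (k : ℕ), l (g ^ k) = k * l g

namespace IsHomogeneousLength

open scoped commutatorElement

variable {K : Type*} [Group K] {l : K → ℝ}

theorem one (hl : IsHomogeneousLength l) : l 1 = 0 := by
  simpa using hl.pow 1 0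

theorem nonneg (hl : IsHomogeneousLength l) (g : K) : 0 ≤ l g := by
  have := hl.mul_le g g⁻¹
  rw [mul_inv_cancel, hl.one, hl.inv] at this
  linarith

theorem zpow (hl : IsHomogeneousLength l) (g : K) (k : ℤ) : l (g ^ k) = |(k : ℝ)| * l g := by
  obtain ⟨n, rfl | rfl⟩ := k.eq_nat_or_neg
  · simp [hl.pow]
  · simp [hl.pow, hl.inv]

theorem mul_comm (hl : IsHomogeneousLength l) (g h : K) : l (g * h) = l (h * g) := by
  rw [← hl.conj (g * h) h]
  group

theorem pow_mul_mul_pow_le (hl : IsHomogeneousLength l) (w y z a : K) (n : ℕ) :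
    l ((w * y) ^ n * a * (z * w⁻¹) ^ n) ≤ n * (l y + l z) + l a := by
  induction n with
  | zero => simp
  | succ n ih =>
    have e : (w * y) ^ (n + 1) * a * (z * w⁻¹) ^ (n + 1) =
        w * (y * ((w * y) ^ n * a * (z * w⁻¹) ^ n) * z) * w⁻¹ := by
      rw [pow_succ', pow_succ (z * w⁻¹)]
      simp only [mul_assoc]
    rw [e, hl.conj]
    have h1 := hl.mul_le (y * ((w * y) ^ n * a * (z * w⁻¹) ^ n)) z
    have h2 := hl.mul_le y ((w * y) ^ n * a * (z * w⁻¹) ^ n)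
    push_cast
    linarith

/-- If `x` is conjugate both to `w * y` and to `z * w⁻¹`, then the factors `w` and `w⁻¹` cancel in
the length of `x ^ n * x ^ n` for large `n`. -/
theorem two_mul_le (hl : IsHomogeneousLength l) {x w y z s t : K}
    (hs : x = s * (w * y) * s⁻¹) (ht : x = t * (z * w⁻¹) * t⁻¹) : 2 * l x ≤ l y + l z := by
  set C := l s + l (s⁻¹ * t) + l t with hC
  have key : ∀ n : ℕ, n * (2 * l x - (l y + l z)) ≤ C := by
    intro n
    have e : x ^ (n + n) = s * ((w * y) ^ n * (s⁻¹ * t) * (z * w⁻¹) ^ n) * t⁻¹ := by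
      rw [pow_add]
      nth_rewrite 1 [hs]
      rw [ht, conj_pow, conj_pow]
      group
    have h1 := hl.pow x (n + n)
    rw [e] at h1
    have h2 := hl.mul_le (s * ((w * y) ^ n * (s⁻¹ * t) * (z * w⁻¹) ^ n)) t⁻¹
    have h3 := hl.mul_le s ((w * y) ^ n * (s⁻¹ * t) * (z * w⁻¹) ^ n)
    have h4 := hl.pow_mul_mul_pow_le w y z (s⁻¹ * t) n
    rw [hl.inv] at h2
    push_cast at h1
    linarith
  by_contra! hlt
  obtain ⟨n, hn⟩ := exists_nat_gt (C / (2 * l x - (l y + l z)))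
  rw [div_lt_iff₀ (by linarith)] at hn
  linarith [key n]

/-- The function `f (m, k) = l (x ^ m * ⁅x, y⁆ ^ k)` is at most the average of its values at
`(m - 1, k)` and `(m + 1, k - 1)`. -/
theorem two_mul_zpow_mul_zpow_le (hl : IsHomogeneousLength l) (x y : K) (m k : ℤ) :
    2 * l (x ^ m * ⁅x, y⁆ ^ k) ≤
      l (x ^ (m - 1) * ⁅x, y⁆ ^ k) + l (x ^ (m + 1) * ⁅x, y⁆ ^ (k - 1)) := by
  have h := hl.two_mul_le (x := x ^ m * ⁅x, y⁆ ^ k) (w := x) (y := x ^ (m - 1) * ⁅x, y⁆ ^ k)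
    (z := y⁻¹ * (x ^ m * ⁅x, y⁆ ^ (k - 1) * x) * y⁻¹⁻¹) (s := 1) (t := y)
    (by rw [one_mul, inv_one, mul_one, ← mul_assoc, ← zpow_one_add, add_sub_cancel])
    (by
      have : ⁅x, y⁆ ^ k = ⁅x, y⁆ ^ (k - 1) * (x * y * x⁻¹ * y⁻¹) := by
        rw [← commutatorElement_def, ← zpow_add_one, sub_add_cancel]
      rw [this]
      simp [mul_assoc])
  rw [hl.conj, hl.mul_comm _ x, ← mul_assoc, ← zpow_one_add, add_comm 1 m] at h
  exact h

/-- Along the two steps `(m, k) ↦ (m - 1, k)` and `(m, k) ↦ (m + 1, k - 1)` the number `m + 2 * k`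
drops by one, while the average of `m ^ 2` grows by one. -/
theorem zpow_mul_zpow_le (hl : IsHomogeneousLength l) (x y : K) {t : ℝ} (ht : 0 < t) (N : ℕ)
    (m k : ℤ) (h : m + 2 * k = N) :
    l (x ^ m * ⁅x, y⁆ ^ k) ≤ (l x + l ⁅x, y⁆) * (((m : ℝ) ^ 2 + N) / t + t) := by
  have hA : 0 ≤ l x + l ⁅x, y⁆ := add_nonneg (hl.nonneg _) (hl.nonneg _)
  induction N generalizing m k with
  | zero =>
    have h1 := hl.mul_le (x ^ m) (⁅x, y⁆ ^ k)
    rw [hl.zpow, hl.zpow] at h1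
    have hk : |(k : ℝ)| ≤ |(m : ℝ)| := by
      have : (m : ℝ) = -2 * k := by
        have : m = -2 * k := by push_cast at h; linarith
        rw [this]
        push_cast
        ring
      rw [this, abs_mul]
      norm_num
      linarith [abs_nonneg (k : ℝ)]
    have hm : |(m : ℝ)| ≤ ((m : ℝ) ^ 2 + (0 : ℕ)) / t + t := by
      rw [div_add' _ _ _ ht.ne', le_div_iff₀ ht, ← sq_abs (m : ℝ)]
      push_cast
      nlinarith [sq_nonneg (|(m : ℝ)| - t), abs_nonneg (m : ℝ)]
    calc _ ≤ |(m : ℝ)| * l x + |(k : ℝ)| * l ⁅x, y⁆ := h1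
      _ ≤ |(m : ℝ)| * l x + |(m : ℝ)| * l ⁅x, y⁆ := by
        gcongr
        exact hl.nonneg _
      _ = (l x + l ⁅x, y⁆) * |(m : ℝ)| := by ring
      _ ≤ _ := by gcongr
  | succ N ih =>
    have h1 := ih (m - 1) k (by push_cast at h; linarith)
    have h2 := ih (m + 1) (k - 1) (by push_cast at h; linarith)
    have h3 := hl.two_mul_zpow_mul_zpow_le x y m k
    push_cast at h1 h2 ⊢
    have e : (l x + l ⁅x, y⁆) * ((((m : ℝ) - 1) ^ 2 + N) / t + t) +
        (l x + l ⁅x, y⁆) * ((((m : ℝ) + 1) ^ 2 + N) / t + t) =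
        2 * ((l x + l ⁅x, y⁆) * (((m : ℝ) ^ 2 + (N + 1)) / t + t)) := by ring
    linarith

theorem commutator_eq_zero (hl : IsHomogeneousLength l) (x y : K) : l ⁅x, y⁆ = 0 := by
  refine le_antisymm ?_ (hl.nonneg _)
  by_contra! hpos
  obtain ⟨j, hj⟩ := exists_nat_gt (3 * (l x + l ⁅x, y⁆) / l ⁅x, y⁆)
  rw [div_lt_iff₀ hpos] at hj
  have hA : 0 < l x + l ⁅x, y⁆ := add_pos_of_nonneg_of_pos (hl.nonneg _) hpos
  have hj0 : (0 : ℝ) < j := by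
    by_contra! h0
    nlinarith
  -- `2 * j ^ 2` steps lead from `(0, j ^ 2)` to points `(m, k)` with `|m|` of the order of `j`
  have h := hl.zpow_mul_zpow_le x y hj0 (2 * j ^ 2) 0 ((j ^ 2 : ℕ) : ℤ) (by push_cast; ring)
  rw [zpow_zero, one_mul, zpow_natCast, hl.pow] at h
  push_cast at h
  have e : ((0 : ℝ) ^ 2 + 2 * (j : ℝ) ^ 2) / j + j = 3 * j := by
    field_simp
    ring
  rw [e] at h
  nlinarith

end IsHomogeneousLength

/-! ### Discrete norms on abelian groups of finite rank -/

/-- A norm on an abelian group `M` (homogeneous with respect to integers) whose values at nonzero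
elements are at least `δ > 0`. -/
structure IsDiscreteNorm {M : Type*} [AddCommGroup M] (p : M → ℝ) (δ : ℝ) : Prop where
  add_le : ∀ a b, p (a + b) ≤ p a + p b
  zsmul : ∀ (k : ℤ) a, p (k • a) = |(k : ℝ)| * p a
  pos : 0 < δ
  le : ∀ a, a ≠ 0 → δ ≤ p a

namespace IsDiscreteNorm

variable {M : Type*} [AddCommGroup M] {p : M → ℝ} {δ : ℝ}

theorem zero (hp : IsDiscreteNorm p δ) : p 0 = 0 := by
  simpa using hp.zsmul 0 0

theorem nonneg (hp : IsDiscreteNorm p δ) (a : M) : 0 ≤ p a := by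
  by_cases h : a = 0
  · rw [h, hp.zero]
  · exact hp.pos.le.trans (hp.le a h)

theorem sum_zsmul_le (hp : IsDiscreteNorm p δ) {n : ℕ} (b : Fin n → M) (z : Fin n → ℤ) :
    p (∑ i, z i • b i) ≤ ∑ i, |(z i : ℝ)| * p (b i) := by
  have h := Finset.le_sum_of_subadditive p hp.zero.le hp.add_le Finset.univ fun i => z i • b i
  simpa only [hp.zsmul] using h

theorem sum_zsmul_le_mul (hp : IsDiscreteNorm p δ) {n : ℕ} (b : Fin n → M) (z : Fin n → ℤ) {r : ℝ}
    (hz : ∀ i, |(z i : ℝ)| ≤ r) : p (∑ i, z i • b i) ≤ r * ∑ i, p (b i) := by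
  rw [Finset.mul_sum]
  exact (hp.sum_zsmul_le b z).trans
    (Finset.sum_le_sum fun i _ => mul_le_mul_of_nonneg_right (hz i) (hp.nonneg _))

/-- A discrete norm dominates the coefficients with respect to linearly independent elements. If
`z` is a vector of relatively small norm, then, by Dirichlet's approximation theorem, some integer
vector close to a multiple of the direction of `z` has norm smaller than `δ`. -/
theorem exists_mul_abs_le (hp : IsDiscreteNorm p δ) {n : ℕ} {b : Fin n → M}
    (hb : LinearIndependent ℤ b) :
    ∃ c > 0, ∀ (z : Fin n → ℤ) (i : Fin n), c * |(z i : ℝ)| ≤ p (∑ i, z i • b i) := by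
  set C := ∑ i, p (b i) with hC
  have hδ := hp.pos
  obtain ⟨k, hk⟩ := exists_nat_gt (2 * C / δ)
  rw [div_lt_iff₀ hδ] at hk
  have hC0 : 0 ≤ C := Finset.sum_nonneg fun i _ => hp.nonneg _
  have hk0 : 0 < k := by
    refine Nat.pos_of_ne_zero fun h0 => ?_
    rw [h0, Nat.cast_zero, zero_mul] at hk
    linarith
  have hkR : (0 : ℝ) < k := by exact_mod_cast hk0
  have hJ : (0 : ℝ) < (k : ℝ) ^ n := by positivity
  refine ⟨δ / (2 * (k : ℝ) ^ n), by positivity, ?_⟩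
  by_contra! hcon
  obtain ⟨z, i, hi⟩ := hcon
  -- the coefficient of `z` of largest absolute value
  obtain ⟨i₀, -, hmax⟩ := Finset.exists_max_image Finset.univ (fun i => |z i|) ⟨i, Finset.mem_univ i⟩
  set m := |z i₀| with hm
  have hzi : p (∑ i, z i • b i) < δ / (2 * (k : ℝ) ^ n) * m := by
    refine hi.trans_le ?_
    have : |(z i : ℝ)| ≤ m := by exact_mod_cast hmax i (Finset.mem_univ i)
    gcongr
  have hm0 : 0 < m := by
    refine (abs_nonneg _).lt_of_ne' fun h0 => ?_
    rw [← hm] at h0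
    rw [h0, Int.cast_zero, mul_zero] at hzi
    exact hzi.not_ge (hp.nonneg _)
  have hmR : (0 : ℝ) < m := by exact_mod_cast hm0
  -- two of the vectors `j • z`, `0 ≤ j ≤ k ^ n`, are close to each other modulo `m`
  obtain ⟨j, hj, j', hj', hne, heq⟩ := Finset.exists_ne_map_eq_of_card_lt_of_maps_to
    (s := Finset.range (k ^ n + 1)) (t := Fintype.piFinset fun _ : Fin n => Finset.Ico (0 : ℤ) k)
    (f := fun j i => k * ((j * z i) % m) / m) (by simp) (by
      intro j _
      simp only [Finset.mem_coe, Fintype.mem_piFinset, Finset.mem_Ico]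
      intro i
      have h1 := Int.emod_nonneg (j * z i) hm0.ne'
      have h2 := Int.emod_lt_of_pos (j * z i) hm0
      refine ⟨Int.ediv_nonneg (by positivity) hm0.le, ?_⟩
      apply Int.ediv_lt_of_lt_mul hm0
      have : (0 : ℤ) < k := by exact_mod_cast hk0
      nlinarith)
  wlog hlt : j < j' generalizing j j'
  · exact this j' hj' j hj hne.symm heq.symm (by omega)
  have hj'k : j' ≤ k ^ n := by simpa [Nat.lt_succ_iff] using hj'
  set e : Fin n → ℤ := fun i => (j' * z i) % m - (j * z i) % m with he
  set w : Fin n → ℤ := fun i => (j' * z i) / m - (j * z i) / m with hw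
  have hwe : ∀ i, m * w i = (j' - j : ℤ) * z i + (-1) * e i := by
    intro i
    have h1 := Int.emod_add_mul_ediv (j' * z i) m
    have h2 := Int.emod_add_mul_ediv (j * z i) m
    simp only [he, hw]
    linear_combination h1 - h2
  have hesmall : ∀ i, |k * e i| < m := by
    intro i
    have h1 := congrFun heq i
    have a1 := Int.emod_add_mul_ediv (k * ((j * z i) % m)) m
    have a2 := Int.emod_add_mul_ediv (k * ((j' * z i) % m)) m
    have b1 := Int.emod_nonneg (k * ((j * z i) % m)) hm0.ne'
    have b2 := Int.emod_lt_of_pos (k * ((j * z i) % m)) hm0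
    have b3 := Int.emod_nonneg (k * ((j' * z i) % m)) hm0.ne'
    have b4 := Int.emod_lt_of_pos (k * ((j' * z i) % m)) hm0
    rw [h1] at a1
    have : k * e i = (k * ((j' * z i) % m)) % m - (k * ((j * z i) % m)) % m := by
      simp only [he]
      linear_combination a1 - a2
    rw [this, abs_lt]
    constructor <;> linarith
  have hw0 : (∑ i, w i • b i) ≠ 0 := by
    intro h0
    have h1 := Fintype.linearIndependent_iff.mp hb w h0 i₀
    have h2 := hwe i₀
    rw [h1, mul_zero] at h2
    have h3 : e i₀ = (j' - j : ℤ) * z i₀ := by linarith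
    have h4 := hesmall i₀
    rw [h3, abs_mul, abs_mul, ← hm] at h4
    have h5 : (1 : ℤ) ≤ |(k : ℤ)| := by rw [Nat.abs_cast]; exact_mod_cast hk0
    have h6 : (1 : ℤ) ≤ |(j' - j : ℤ)| := by rw [abs_of_pos] <;> omega
    nlinarith [mul_nonneg (sub_nonneg.mpr h5) (mul_nonneg (abs_nonneg (j' - j : ℤ)) hm0.le)]
  have hsum : m • ∑ i, w i • b i = (j' - j : ℤ) • ∑ i, z i • b i + (-1 : ℤ) • ∑ i, e i • b i := by
    simp only [Finset.smul_sum, smul_smul, ← Finset.sum_add_distrib, ← add_smul, hwe]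
  have h1 := hp.add_le ((j' - j : ℤ) • ∑ i, z i • b i) ((-1 : ℤ) • ∑ i, e i • b i)
  rw [← hsum, hp.zsmul, hp.zsmul, hp.zsmul, abs_of_pos hmR] at h1
  have h2 : p (∑ i, e i • b i) ≤ m / k * C := hp.sum_zsmul_le_mul b e fun i => by
    rw [le_div_iff₀ hkR]
    have : |(k : ℝ) * e i| < m := by exact_mod_cast hesmall i
    rw [abs_mul, Nat.abs_cast] at this
    linarith
  have h3 : |((j' - j : ℤ) : ℝ)| ≤ (k : ℝ) ^ n := by
    rw [abs_of_pos (by exact_mod_cast (by omega : (0 : ℤ) < j' - j))]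
    have : (j' : ℝ) ≤ (k : ℝ) ^ n := by exact_mod_cast hj'k
    push_cast
    linarith [(Nat.cast_nonneg j : (0 : ℝ) ≤ j)]
  have h4 : |((j' - j : ℤ) : ℝ)| * p (∑ i, z i • b i) ≤ m * (δ / 2) := by
    calc _ ≤ (k : ℝ) ^ n * (δ / (2 * (k : ℝ) ^ n) * m) :=
          mul_le_mul h3 hzi.le (hp.nonneg _) hJ.le
      _ = m * (δ / 2) := by field_simp
  have h5 : m / k * C < m * (δ / 2) := by
    rw [div_mul_eq_mul_div, div_lt_iff₀ hkR, mul_assoc]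
    gcongr
    linarith
  have h6 := mul_le_mul_of_nonneg_left (hp.le _ hw0) hmR.le
  norm_num at h1 h4
  linarith

/-- If `b` has as many elements as the rank of `M`, then every element is at bounded distance from
an integral combination: some multiple of it is such a combination, whose coefficients can be
divided with remainder. -/
theorem exists_sub_sum_le (hp : IsDiscreteNorm p δ) {n : ℕ} {b : Fin n → M}
    (hb : LinearIndependent ℤ b) (hn : Module.rank ℤ M = n) (a : M) :
    ∃ z : Fin n → ℤ, p (a - ∑ i, z i • b i) ≤ ∑ i, p (b i) := by
  have hq : Module.rank ℤ (M ⧸ Submodule.span ℤ (Set.range b)) = 0 := by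
    have h1 := Submodule.rank_quotient_add_rank (Submodule.span ℤ (Set.range b))
    have h2 : Module.rank ℤ (Submodule.span ℤ (Set.range b)) = n := by
      rw [rank_span hb, ← Nat.cast_card, Nat.card_range_of_injective hb.injective, Nat.card_fin]
    rw [h2, hn] at h1
    have h3 : Module.rank ℤ (M ⧸ Submodule.span ℤ (Set.range b)) + n = 0 + n := by
      rw [h1, zero_add]
    exact Cardinal.eq_of_add_eq_add_right h3 (Cardinal.natCast_lt_aleph0)
  obtain ⟨m, hm, hma⟩ := rank_eq_zero_iff.mp hq (Submodule.Quotient.mk a)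
  rw [← Submodule.Quotient.mk_smul, Submodule.Quotient.mk_eq_zero,
    Submodule.mem_span_range_iff_exists_fun] at hma
  obtain ⟨y, hy⟩ := hma
  refine ⟨fun i => y i / m, ?_⟩
  have e : m • (a - ∑ i, (y i / m) • b i) = ∑ i, (y i % m) • b i := by
    rw [smul_sub, ← hy, Finset.smul_sum, ← Finset.sum_sub_distrib]
    refine Finset.sum_congr rfl fun i _ => ?_
    rw [smul_smul, ← sub_smul, Int.emod_def]
  have hmR : (0 : ℝ) < |(m : ℝ)| := abs_pos.mpr (by exact_mod_cast hm)
  have h := hp.sum_zsmul_le_mul b (fun i => y i % m) (r := |(m : ℝ)|) fun i => by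
    rw [abs_of_nonneg (by exact_mod_cast Int.emod_nonneg (y i) hm)]
    exact_mod_cast (Int.emod_lt_abs (y i) hm).le
  rw [← e, hp.zsmul] at h
  exact le_of_mul_le_mul_left h hmR

/-- A space which is parametrized, up to a quasi-isometry, by an abelian group of rank `n` with a
discrete norm is quasi-isometric to `ℝⁿ`. -/
theorem exists_isQuasiIsometry (hp : IsDiscreteNorm p δ) {n : ℕ} (hn : Module.rank ℤ M = n)
    {Y : Type*} [PseudoMetricSpace Y] (g : M → Y) {L C R : ℝ} (hL : 1 ≤ L) (hC : 0 ≤ C)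
    (hlower : ∀ a b, L⁻¹ * p (a - b) - C ≤ dist (g a) (g b))
    (hupper : ∀ a b, dist (g a) (g b) ≤ L * p (a - b) + C)
    (hR : ∀ y, ∃ a, dist (g a) y ≤ R) :
    ∃ f : EuclideanSpace ℝ (Fin n) → Y, IsQuasiIsometry f := by
  obtain ⟨b, hb⟩ := exists_linearIndependent_of_le_rank hn.ge
  obtain ⟨c, hc, hcb⟩ := hp.exists_mul_abs_le hb
  set B := ∑ i, p (b i) with hB
  have hB0 : 0 ≤ B := Finset.sum_nonneg fun i _ => hp.nonneg _
  have hL0 : 0 < L := by linarith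
  set s : EuclideanSpace ℝ (Fin n) → M := fun v => ∑ i, ⌊v i⌋ • b i with hs
  have hss : ∀ v w, s v - s w = ∑ i, (⌊v i⌋ - ⌊w i⌋) • b i := fun v w => by
    simp only [hs, ← Finset.sum_sub_distrib, sub_smul]
  have hfl : ∀ x y : ℝ, |((⌊x⌋ - ⌊y⌋ : ℤ) : ℝ)| ≤ |x - y| + 1 ∧
      |x - y| ≤ |((⌊x⌋ - ⌊y⌋ : ℤ) : ℝ)| + 1 := by
    intro x y
    have key : |((⌊x⌋ - ⌊y⌋ : ℤ) : ℝ) - (x - y)| ≤ 1 := by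
      push_cast
      rw [abs_le]
      constructor <;>
        linarith [Int.floor_le x, Int.floor_le y, Int.lt_floor_add_one x, Int.lt_floor_add_one y]
    have h1 := abs_sub_abs_le_abs_sub ((⌊x⌋ - ⌊y⌋ : ℤ) : ℝ) (x - y)
    have h2 := abs_sub_abs_le_abs_sub (x - y) ((⌊x⌋ - ⌊y⌋ : ℤ) : ℝ)
    rw [abs_sub_comm (x - y)] at h2
    constructor <;> linarith
  have hup : ∀ v w, p (s v - s w) ≤ (dist v w + 1) * B := by
    intro v w
    rw [hss]
    refine hp.sum_zsmul_le_mul b _ fun i => (hfl _ _).1.trans ?_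
    have := PiLp.dist_apply_le v w i
    rw [Real.dist_eq] at this
    linarith
  have hlow : ∀ v w, dist v w ≤ (n / c + n + 1) * (p (s v - s w) + 1) := by
    intro v w
    have h1 : dist v w ≤ ∑ i, |v i - w i| := by
      rw [EuclideanSpace.dist_eq, Real.sqrt_le_left (Finset.sum_nonneg fun i _ => abs_nonneg _)]
      simp only [Real.dist_eq]
      exact Finset.sum_sq_le_sq_sum_of_nonneg fun i _ => abs_nonneg _
    have h2 : ∀ i ∈ Finset.univ, |v i - w i| ≤ p (s v - s w) / c + 1 := by
      intro i _
      refine (hfl _ _).2.trans ?_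
      have := hcb (fun i => ⌊v i⌋ - ⌊w i⌋) i
      rw [← hss] at this
      have : |((⌊v i⌋ - ⌊w i⌋ : ℤ) : ℝ)| ≤ p (s v - s w) / c := by
        rw [le_div_iff₀ hc]
        linarith
      linarith
    have h3 := Finset.sum_le_card_nsmul _ _ _ h2
    rw [Finset.card_univ, Fintype.card_fin, nsmul_eq_mul] at h3
    have h4 := hp.nonneg (s v - s w)
    have h5 : 0 ≤ (n : ℝ) / c := by positivity
    have h6 : (n : ℝ) * (p (s v - s w) / c + 1) = n / c * p (s v - s w) + n := by ring
    nlinarith [mul_nonneg (Nat.cast_nonneg n : (0 : ℝ) ≤ n) h4]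
  set A := (n : ℝ) / c + n + 1 with hA
  have hA1 : 1 ≤ A := by
    have : 0 ≤ (n : ℝ) / c := by positivity
    have : (0 : ℝ) ≤ n := Nat.cast_nonneg n
    linarith
  have hA0 : 0 < A := by linarith
  refine ⟨fun v => g (s v), ⟨L * (A + B), 1 + L * B + C, ?_, by positivity, fun v w => ⟨?_, ?_⟩⟩,
    L * B + C + R, fun y => ?_⟩
  · nlinarith
  · have h1 := hlower (s v) (s w)
    have h2 := hlow v w
    have h3 : A⁻¹ * dist v w ≤ p (s v - s w) + 1 := by
      rw [inv_mul_le_iff₀ hA0]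
      exact h2
    have h4 : (L * (A + B))⁻¹ * dist v w ≤ L⁻¹ * (A⁻¹ * dist v w) := by
      rw [← mul_assoc, ← mul_inv]
      gcongr
      linarith
    have h5 : L⁻¹ * (A⁻¹ * dist v w) ≤ L⁻¹ * (p (s v - s w) + 1) := by gcongr
    have h6 : L⁻¹ ≤ 1 := inv_le_one_of_one_le₀ hL
    have h7 : 0 ≤ L * B := by positivity
    linarith
  · have h1 := hupper (s v) (s w)
    have h2 := mul_le_mul_of_nonneg_left (hup v w) hL0.le
    have h3 : 0 ≤ L * A * dist v w := by positivity
    linarith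
  · obtain ⟨a, ha⟩ := hR y
    obtain ⟨z, hz⟩ := hp.exists_sub_sum_le hb hn a
    refine ⟨WithLp.toLp 2 fun i => (z i : ℝ), ?_⟩
    have e : s (WithLp.toLp 2 fun i => (z i : ℝ)) = ∑ i, z i • b i := by simp [hs]
    change dist (g (s _)) y ≤ _
    rw [e]
    have h1 := hupper a (∑ i, z i • b i)
    rw [dist_comm] at h1
    have h2 := dist_triangle (g (∑ i, z i • b i)) (g a) y
    have h3 := mul_le_mul_of_nonneg_left hz hL0.le
    linarith

end IsDiscreteNorm

/-! ### Flat groups and their orbits -/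

namespace BicontAut

open CompactOpenSubgroup
open scoped commutatorElement

variable {G : Type*} [Group G] [TopologicalSpace G]

theorem dist_smul_smul (α : BicontAut G) (V W : CompactOpenSubgroup G) :
    dist (α • V) (α • W) = dist V W := by
  rw [dist_def, dist_def, idx_smul, idx_smul]

variable [IsTopologicalGroup G]

theorem log_two_le_dist {V W : CompactOpenSubgroup G} (h : V ≠ W) : Real.log 2 ≤ dist V W := by
  have h1 : (0 : ℝ) < dist V W := dist_pos.mpr h
  rw [dist_def] at h1 ⊢
  have h2 : (1 : ℝ) < (V.idx W : ℝ) * (W.idx V : ℝ) := by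
    by_contra! hle
    exact h1.not_ge (Real.log_nonpos (idx_mul_pos V W).le hle)
  have h3 : 1 < V.idx W * W.idx V := by exact_mod_cast h2
  apply Real.log_le_log (by norm_num)
  exact_mod_cast h3

/-- The displacement of a common tidy subgroup is a homogeneous length on a flat group; it is
conjugation invariant since it is the minimal displacement. -/
theorem isHomogeneousLength_dist_smul {Γ : Subgroup (BicontAut G)} {O : CompactOpenSubgroup G}
    (hO : ∀ α ∈ Γ, IsTidy O α) : IsHomogeneousLength fun α : Γ => dist (α.1 • O) O where
  mul_le α β := by
    rw [Subgroup.coe_mul, mul_smul, add_comm, ← dist_smul_smul α.1 (β.1 • O)]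
    exact dist_triangle _ _ _
  inv α := by
    rw [Subgroup.coe_inv, ← dist_smul_smul α.1, smul_inv_smul, dist_comm]
  conj α β := by
    apply le_antisymm
    · refine (hO _ (β * α * β⁻¹).2 (β.1 • O)).trans_eq ?_
      rw [Subgroup.coe_mul, Subgroup.coe_mul, Subgroup.coe_inv, mul_smul, inv_smul_smul, mul_smul,
        dist_smul_smul]
    · refine (hO _ α.2 (β.1⁻¹ • O)).trans_eq ?_
      rw [Subgroup.coe_mul, Subgroup.coe_mul, Subgroup.coe_inv,
        ← dist_smul_smul β.1, smul_inv_smul, mul_smul, mul_smul]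
  pow α k := by
    rw [Subgroup.coe_pow]
    exact dist_pow_smul (fun j => hO _ (pow_mem α.2 j)) k

theorem mem_scaleOne_iff {Γ : Subgroup (BicontAut G)} (hΓ : IsFlat Γ) {O : CompactOpenSubgroup G}
    (hO : ∀ α ∈ Γ, IsTidy O α) (α : Γ) : α ∈ scaleOne Γ hΓ ↔ α.1 • O = O :=
  scale_eq_one_iff (hO _ α.2)

/-- The quotient of a flat group `Γ` by `Γ(1)` is abelian, so that the kernel of the projection to
its abelianization is `Γ(1)`. -/
theorem mk_eq_one_iff {Γ : Subgroup (BicontAut G)} (hΓ : IsFlat Γ) (α : Γ) :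
    Abelianization.of (α : Γ ⧸ scaleOne Γ hΓ) = 1 ↔ α ∈ scaleOne Γ hΓ := by
  have hcomm : commutator (Γ ⧸ scaleOne Γ hΓ) = ⊥ := by
    rw [eq_bot_iff, commutator_def, Subgroup.commutator_le]
    intro x _ y _
    obtain ⟨x, rfl⟩ := QuotientGroup.mk_surjective x
    obtain ⟨y, rfl⟩ := QuotientGroup.mk_surjective y
    obtain ⟨O, hO⟩ := id hΓ
    have h := (isHomogeneousLength_dist_smul hO).commutator_eq_zero x y
    have h' : ⁅x, y⁆ ∈ scaleOne Γ hΓ :=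
      (mem_scaleOne_iff _ hO _).mpr (eq_of_dist_eq_zero h)
    exact (QuotientGroup.eq_one_iff _).mpr h'
  rw [← MonoidHom.mem_ker, Abelianization.ker_of, hcomm, Subgroup.mem_bot,
    QuotientGroup.eq_one_iff]

/-- On a flat group, the displacement of a common tidy subgroup is the pullback of a discrete norm
on the abelianization of `Γ ⧸ Γ(1)`. -/
theorem exists_isDiscreteNorm {Γ : Subgroup (BicontAut G)} (hΓ : IsFlat Γ)
    {O : CompactOpenSubgroup G} (hO : ∀ α ∈ Γ, IsTidy O α) :
    ∃ p : Additive (Abelianization (Γ ⧸ scaleOne Γ hΓ)) → ℝ, IsDiscreteNorm p (Real.log 2) ∧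
      ∀ α β : Γ, p (.ofMul (.of (α : Γ ⧸ scaleOne Γ hΓ)) - .ofMul (.of (β : Γ ⧸ scaleOne Γ hΓ))) =
        dist (α.1 • O) (β.1 • O) := by
  have hl := isHomogeneousLength_dist_smul hO
  set φ : Γ →* Abelianization (Γ ⧸ scaleOne Γ hΓ) :=
    Abelianization.of.comp (QuotientGroup.mk' (scaleOne Γ hΓ)) with hφ
  have hsurj : Function.Surjective φ := by
    intro a
    obtain ⟨a, rfl⟩ := QuotientGroup.mk_surjective a
    obtain ⟨a, rfl⟩ := QuotientGroup.mk_surjective a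
    exact ⟨a, rfl⟩
  have hker : ∀ α, φ α = 1 ↔ α.1 • O = O := fun α =>
    (mk_eq_one_iff hΓ α).trans (mem_scaleOne_iff hΓ hO α)
  have hwell : ∀ α β, φ α = φ β → α.1 • O = β.1 • O := by
    intro α β h
    have h1 := (hker (β⁻¹ * α)).mp (by rw [map_mul, map_inv, h, inv_mul_cancel])
    rw [Subgroup.coe_mul, Subgroup.coe_inv, mul_smul, inv_smul_eq_iff] at h1
    exact h1
  set p : Additive (Abelianization (Γ ⧸ scaleOne Γ hΓ)) → ℝ :=
    fun a => dist ((Function.surjInv hsurj a.toMul).1 • O) O with hp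
  have hpφ : ∀ α, p (.ofMul (φ α)) = dist (α.1 • O) O := fun α => by
    simp only [hp, toMul_ofMul]
    rw [hwell _ α (Function.surjInv_eq hsurj _)]
  have hs : ∀ a : Additive (Abelianization (Γ ⧸ scaleOne Γ hΓ)), ∃ α, .ofMul (φ α) = a := fun a =>
    (hsurj a.toMul).imp fun α h => by rw [h, ofMul_toMul]
  refine ⟨p, ⟨?_, ?_, Real.log_pos (by norm_num), ?_⟩, ?_⟩
  · intro a b
    obtain ⟨α, rfl⟩ := hs a
    obtain ⟨β, rfl⟩ := hs b
    rw [← ofMul_mul, ← map_mul, hpφ, hpφ, hpφ]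
    exact hl.mul_le α β
  · intro k a
    obtain ⟨α, rfl⟩ := hs a
    rw [← ofMul_zpow, ← map_zpow, hpφ, hpφ]
    exact hl.zpow α k
  · intro a ha
    obtain ⟨α, rfl⟩ := hs a
    rw [hpφ]
    refine log_two_le_dist fun h => ha ?_
    rw [(hker α).mpr h, ofMul_one]
  · intro α β
    have h1 := hpφ (α * β⁻¹)
    have h2 := hl.mul_comm α β⁻¹
    rw [h2, Subgroup.coe_mul, Subgroup.coe_inv, mul_smul, ← dist_smul_smul β.1,
      smul_inv_smul] at h1
    rw [← h1, map_mul, map_inv, ofMul_mul, ofMul_inv, sub_eq_add_neg]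
    rfl

end BicontAut

theorem mainTheorem8 {G : Type*} [Group G] [TopologicalSpace G] [IsTopologicalGroup G]
    [LocallyCompactSpace G] [TotallyDisconnectedSpace G]
    {X : Type*} [MetricSpace X] [MulAction G X]
    (hstab : ∀ x : X, IsCompact (MulAction.stabilizer G x : Set G) ∧
      IsOpen (MulAction.stabilizer G x : Set G))
    (hqi : IsQuasiIsometricEmbedding (stabilizerMap hstab))
    (H : Subgroup G) (hH : IsFlatSubgroup H) (n : ℕ) (hn : flatRankSubgroup H hH = n) (x : X) :
    IsQuasiFlat n (MulAction.orbit H x) := by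
  have hΓ : BicontAut.IsFlat (H.map (BicontAut.innerAut G)) := hH
  obtain ⟨O, hO⟩ := id hΓ
  obtain ⟨p, hp, hpdist⟩ := BicontAut.exists_isDiscreteNorm hΓ hO
  obtain ⟨L, C, hL, hC, hLC⟩ := hqi
  have hL0 : 0 < L := by linarith
  set r := dist (stabilizerMap hstab x) O with hr
  have hr0 : 0 ≤ r := dist_nonneg
  have hsm : ∀ h : G, stabilizerMap hstab (h • x) =
      BicontAut.innerAut G h • stabilizerMap hstab x := fun h =>
    Subtype.ext (MulAction.stabilizer_smul_eq_stabilizer_map_conj h x)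
  set ψ : H → Additive (Abelianization (H.map (BicontAut.innerAut G) ⧸
      BicontAut.scaleOne (H.map (BicontAut.innerAut G)) hΓ)) := fun h =>
    .ofMul (.of ((⟨BicontAut.innerAut G h, Subgroup.mem_map_of_mem _ h.2⟩ :
      H.map (BicontAut.innerAut G)) : H.map (BicontAut.innerAut G) ⧸
        BicontAut.scaleOne (H.map (BicontAut.innerAut G)) hΓ)) with hψ
  have hψs : Function.Surjective ψ := by
    intro a
    obtain ⟨q, hq⟩ := QuotientGroup.mk_surjective a.toMul
    obtain ⟨⟨_, h, hh, rfl⟩, rfl⟩ := QuotientGroup.mk_surjective q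
    exact ⟨⟨h, hh⟩, hq⟩
  -- stabilizers of the points of the orbit are uniformly close to the translates of `O`
  have hD : ∀ h h' : H, |dist (stabilizerMap hstab (h.1 • x)) (stabilizerMap hstab (h'.1 • x)) -
      p (ψ h - ψ h')| ≤ 2 * r := by
    intro h h'
    rw [hpdist]
    have h1 := dist_dist_dist_le (stabilizerMap hstab (h.1 • x)) (stabilizerMap hstab (h'.1 • x))
      (BicontAut.innerAut G h • O) (BicontAut.innerAut G h' • O)
    rw [Real.dist_eq, hsm, hsm, BicontAut.dist_smul_smul, BicontAut.dist_smul_smul, ← hr,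
      ← two_mul] at h1
    rwa [hsm, hsm]
  have hlow : ∀ h h' : H, L⁻¹ * p (ψ h - ψ h') - L * (2 * r + C) ≤ dist (h.1 • x) (h'.1 • x) := by
    intro h h'
    have h1 := (hLC (h.1 • x) (h'.1 • x)).2
    have h2 := (abs_le.mp (hD h h')).1
    have h3 : L⁻¹ * p (ψ h - ψ h') ≤ dist (h.1 • x) (h'.1 • x) + L⁻¹ * (2 * r + C) := by
      rw [inv_mul_le_iff₀ hL0, mul_add, mul_inv_cancel_left₀ hL0.ne']
      linarith
    have h4 : L⁻¹ * (2 * r + C) ≤ L * (2 * r + C) := by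
      have := (inv_le_one_of_one_le₀ hL).trans hL
      gcongr
    linarith
  have hup : ∀ h h' : H, dist (h.1 • x) (h'.1 • x) ≤ L * p (ψ h - ψ h') + L * (2 * r + C) := by
    intro h h'
    have h1 := (hLC (h.1 • x) (h'.1 • x)).1
    have h2 := (abs_le.mp (hD h h')).2
    have h3 : L⁻¹ * dist (h.1 • x) (h'.1 • x) ≤ p (ψ h - ψ h') + (2 * r + C) := by linarith
    rw [inv_mul_le_iff₀ hL0] at h3
    linarith
  have hinv := Function.surjInv_eq hψs
  refine hp.exists_isQuasiIsometry hn
    (fun a => ⟨Function.surjInv hψs a • x, MulAction.mem_orbit _ _⟩) hL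
    (C := L * (2 * r + C)) (R := L * (2 * r + C)) (by positivity) (fun a b => ?_) (fun a b => ?_) ?_
  · have := hlow (Function.surjInv hψs a) (Function.surjInv hψs b)
    rwa [hinv, hinv] at this
  · have := hup (Function.surjInv hψs a) (Function.surjInv hψs b)
    rwa [hinv, hinv] at this
  · rintro ⟨_, h, rfl⟩
    refine ⟨ψ h, ?_⟩
    have := hup (Function.surjInv hψs (ψ h)) h
    rwa [hinv, sub_self, hp.zero, mul_zero, zero_add] at this
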